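/- Let $b:\mathbb R\to\mathbb R$ satisfy $b(t)\ge b_0$ for all $t$ with a constant $b_0>0$, and let $b\in C_b^\infty(-\infty,1]\cap C_b^\infty[1,\infty)$, i.e. on each of the two sides of $t=1$ the function $b$ coincides with a smooth function on the closed half-line that is bounded together with all its derivatives ($b$ may have a jump at $t=1$). Let $\psi\in C_0^\infty(\mathbb R)$ be non-negative and even with $\operatorname{supp}\psi=[-K,K]$, $K>0$, and $\int\psi=1$. For $\epsilon\in(0,1]$ put $\psi_\epsilon(t)=\epsilon^{-1}\psi(\epsilon^{-1}t)$ and $b_\epsilon=b*\psi_\epsilon$. For $u_0\in H^1(\mathbb R^n)$ and $u_1\in L^2(\mathbb R^n)$ consider the regularised Cauchy problem $$u_{tt}-\Delta u+\frac{b_\epsilon'(t)}{b_\epsilon(t)}\,u_t=0\quad\text{on }[0,2]\times\mathbb R^n,\qquad u(0)=u_0,\quad u_t(0)=u_1. \tag{1}$$ A solution of (1) is a function $u\in C([0,2];H^1)\cap C^1([0,2];L^2)\cap C^2([0,2];H^{-1})$ that satisfies the equation for every $t\in[0,2]$ in the sense of distributions on $\mathbb R^n$, and the initial conditions. Then: 1.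 For every $\epsilon\in(0,1]$ and all $u_0\in H^1(\mathbb R^n)$, $u_1\in L^2(\mathbb R^n)$, problem (1) has exactly one solution $u_\epsilon$ on $[0,2]$. 2. For every $k\in\mathbb N_0$ we have $u_\epsilon\in C^{1+k}([0,2];H^{-k})\cap C^{k}([0,2];H^{1-k})$, and there is a constant $c_k$, depending only on $k$, $n$, $b$ and $\psi$, such that for all $u_0,u_1$, all $\epsilon\in(0,1]$ and all $t\in[0,2]$ $$\|\partial_t^{1+k}u_\epsilon(t,\cdot)\|_{H^{-k}(\mathbb R^n)}+\|\partial_t^{k}u_\epsilon(t,\cdot)\|_{H^{1-k}(\mathbb R^n)}\le C_k\,\epsilon^{-k},\qquad C_k=c_k\big(\|u_0\|_{H^1}+\|u_1\|_{L^2}\big).$$ 3. Consequently the net $(u_\epsilon)_{\epsilon\in(0,1]}$ is a very weak solution of energy type of the singular problem $u_{tt}-\Delta u+\frac{b'(t)}{b(t)}u_t=0$, $u(0)=u_0$, $u_t(0)=u_1$; in particular such a solution exists. Here this means that: the coefficients $\mathfrak d_\epsilon=b_\epsilon'/b_\epsilon$ are smooth on $[0,2]$ and moderate, i.e. for some $N\in\mathbb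 R$ and every $k$ there is a constant $C$ with $\sup_{t\in[0,2]}|\partial_t^k\mathfrak d_\epsilon(t)|\le C\epsilon^{N-k}$ for all $\epsilon\in(0,1]$; each $u_\epsilon$ solves (1); and $(u_\epsilon)$ is moderate of energy type, i.e. $u_\epsilon\in C^{1+k}([0,2];H^{-k})\cap C^{k}([0,2];H^{1-k})$ for all $k$, and for some $N\in\mathbb R$ and every $k$ there is a constant $C$ with $\sup_{t\in[0,2]}\big(\|\partial_t^{1+k}u_\epsilon(t)\|_{H^{-k}}+\|\partial_t^{k}u_\epsilon(t)\|_{H^{1-k}}\big)\le C\epsilon^{N-k}$ for all $\epsilon\in(0,1]$. -/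

import Mathlib

open MeasureTheory Set
open scoped SchwartzMap ContDiff Laplacian

noncomputable section

/-! ### Sobolev spaces `H^s(ℝⁿ)` as normed spaces -/

/-- The space `ℝⁿ`. -/
abbrev Rn (n : ℕ) : Type := EuclideanSpace ℝ (Fin n)

/-- The complex Lebesgue space `L²(ℝⁿ)`. -/
abbrev L2 (n : ℕ) : Type := Lp ℂ 2 (volume : Measure (Rn n))

/-- The tempered distributions of Sobolev class `H^s`. -/
def sobolevSubmodule (n : ℕ) (s : ℝ) : Submodule ℂ 𝓢'(Rn n, ℂ) where
  carrier := {f | TemperedDistribution.MemSobolev s 2 f}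
  add_mem' hf hg := hf.add hg
  zero_mem' := TemperedDistribution.memSobolev_fun_zero (Rn n) ℂ s 2
  smul_mem' c _ hf := hf.smul c

/-- The Sobolev space `H^s(ℝⁿ)`. It is not an `abbrev`, so that it carries the norm topology
defined below and not the weak topology inherited from tempered distributions. -/
def Sobolev (n : ℕ) (s : ℝ) : Type := sobolevSubmodule n s

namespace Sobolev

variable {n : ℕ} {s s' : ℝ}

instance : AddCommGroup (Sobolev n s) := inferInstanceAs (AddCommGroup (sobolevSubmodule n s))

instance : Module ℂ (Sobolev n s) := inferInstanceAs (Module ℂ (sobolevSubmodule n s))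

/-- An element of `H^s(ℝⁿ)`, regarded as a tempered distribution. -/
def toDist : Sobolev n s →ₗ[ℂ] 𝓢'(Rn n, ℂ) := (sobolevSubmodule n s).subtype

theorem memSobolev (f : Sobolev n s) : TemperedDistribution.MemSobolev s 2 (toDist f) := f.2

theorem toDist_injective : Function.Injective (toDist : Sobolev n s → 𝓢'(Rn n, ℂ)) :=
  Subtype.val_injective

theorem L2_toDist_injective :
    Function.Injective (fun f : L2 n => (f : 𝓢'(Rn n, ℂ))) := by
  have h := Lp.ker_toTemperedDistributionCLM_eq_bot (F := ℂ)
    (μ := (volume : Measure (Rn n))) (p := 2)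
  exact LinearMap.ker_eq_bot.mp h

/-- The `L²` function `⟨D⟩^s f` attached to `f ∈ H^s`. -/
def besselFun (f : Sobolev n s) : L2 n := (memSobolev f).choose

theorem besselFun_spec (f : Sobolev n s) :
    TemperedDistribution.besselPotential (Rn n) ℂ s (toDist f) = (besselFun f : 𝓢'(Rn n, ℂ)) :=
  (memSobolev f).choose_spec

/-- The map `⟨D⟩^s : H^s → L²`. -/
def bessel : Sobolev n s →ₗ[ℂ] L2 n where
  toFun := besselFun
  map_add' f g := by
    apply L2_toDist_injective
    have h := Lp.toTemperedDistributionCLM_apply (F := ℂ) (μ := (volume : Measure (Rn n))) (p := 2)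
    simp only [← h, map_add]
    simp only [h, ← besselFun_spec, map_add]
  map_smul' c f := by
    apply L2_toDist_injective
    have h := Lp.toTemperedDistributionCLM_apply (F := ℂ) (μ := (volume : Measure (Rn n))) (p := 2)
    simp only [← h, map_smul, RingHom.id_apply]
    simp only [h, ← besselFun_spec, map_smul]

theorem bessel_injective : Function.Injective (bessel : Sobolev n s → L2 n) := by
  intro f g hfg
  apply toDist_injective
  have h : TemperedDistribution.besselPotential (Rn n) ℂ s (toDist f) =
      TemperedDistribution.besselPotential (Rn n) ℂ s (toDist g) := by
    rw [besselFun_spec, besselFun_spec]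
    exact congrArg (fun v : L2 n => (v : 𝓢'(Rn n, ℂ))) hfg
  have h' := congrArg (TemperedDistribution.besselPotential (Rn n) ℂ (-s)) h
  simpa using h'

/-- The norm of `H^s` is `‖f‖_{H^s} = ‖⟨D⟩^s f‖_{L²}`. -/
instance : NormedAddCommGroup (Sobolev n s) :=
  NormedAddCommGroup.induced (Sobolev n s) (L2 n) bessel bessel_injective

instance : NormedSpace ℂ (Sobolev n s) := NormedSpace.induced ℂ (Sobolev n s) (L2 n) bessel

theorem norm_eq (f : Sobolev n s) : ‖f‖ = ‖bessel f‖ := rfl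

/-- The embedding `H^s ⊆ H^{s'}` for `s' ≤ s`. -/
def incl (h : s' ≤ s) (f : Sobolev n s) : Sobolev n s' := ⟨toDist f, (memSobolev f).mono h⟩

end Sobolev

/-! ### The coefficient and its regularisation -/

/-- `f ∈ C_b^∞(I)`: `f` is smooth on `I`, and `f` and all its derivatives are bounded on `I`. -/
def IsCbInfty (I : Set ℝ) (f : ℝ → ℝ) : Prop :=
  ContDiffOn ℝ ∞ f I ∧ ∀ k : ℕ, ∃ C : ℝ, ∀ t ∈ I, |iteratedDerivWithin k f I t| ≤ C

/-- `b ∈ C_b^∞(-∞,1] ∩ C_b^∞[1,∞)`: on either side of `t = 1`, `b` agrees with a `C_b^∞` function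
on the closed half-line. The two one-sided limits at `1` may be different, and the value `b 1`
is not restricted. -/
def IsPiecewiseCbInfty (b : ℝ → ℝ) : Prop :=
  ∃ bl br : ℝ → ℝ, IsCbInfty (Iic 1) bl ∧ IsCbInfty (Ici 1) br ∧
    EqOn b bl (Iio 1) ∧ EqOn b br (Ioi 1)

/-- A smooth, non-negative and symmetric mollifier of integral one with support `[-K, K]`. -/
structure IsMollifier (K : ℝ) (ψ : ℝ → ℝ) : Prop where
  contDiff : ContDiff ℝ ∞ ψ
  nonneg : ∀ t, 0 ≤ ψ t
  symm : ∀ t, ψ (-t) = ψ t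
  support : tsupport ψ = Icc (-K) K
  integral : ∫ t, ψ t = 1

/-- The rescaled mollifier `ψ_ε(t) = ε⁻¹ ψ(ε⁻¹ t)`. -/
def rescaled (ψ : ℝ → ℝ) (ε t : ℝ) : ℝ := ε⁻¹ * ψ (ε⁻¹ * t)

/-- The regularised coefficient `b_ε = b ∗ ψ_ε`, that is `b_ε(t) = ∫ b(s) ψ_ε(t - s) ds`. -/
def regularised (b ψ : ℝ → ℝ) (ε t : ℝ) : ℝ := ∫ s, b s * rescaled ψ ε (t - s)

/-- The regularised dissipation coefficient `b_ε' / b_ε`. -/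
def dissipation (b ψ : ℝ → ℝ) (ε t : ℝ) : ℝ :=
  deriv (regularised b ψ ε) t / regularised b ψ ε t

/-! ### Solutions and moderateness -/

/-- A curve in `H¹(ℝⁿ)`, regarded as a curve in `H^s(ℝⁿ)`, where `s ≤ 1`. -/
def curveIn {n : ℕ} {s : ℝ} (hs : s ≤ 1) (u : ℝ → Sobolev n 1) (t : ℝ) : Sobolev n s :=
  Sobolev.incl hs (u t)

/-- The derivative `∂_t^k u(t)` on the time interval `[0,2]`, taken in `H^s(ℝⁿ)`. -/
def timeDeriv {n : ℕ} {s : ℝ} (hs : s ≤ 1) (k : ℕ) (u : ℝ → Sobolev n 1) (t : ℝ) : Sobolev n s :=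
  iteratedDerivWithin k (curveIn hs u) (Icc 0 2) t

/-- `u` is a finite energy solution on `[0,2]` of the Cauchy problem
`u_tt - Δu + d(t) u_t = 0`, `u(0) = u₀`, `u_t(0) = u₁`: it belongs to
`C([0,2]; H¹) ∩ C¹([0,2]; L²) ∩ C²([0,2]; H⁻¹)`, and the equation holds at every time in the sense
of distributions on `ℝⁿ`. -/
structure IsEnergySolution {n : ℕ} (d : ℝ → ℝ) (u₀ : Sobolev n 1) (u₁ : L2 n)
    (u : ℝ → Sobolev n 1) : Prop where
  continuousOn : ContinuousOn u (Icc 0 2)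
  contDiffOn_one : ContDiffOn ℝ 1 (curveIn (s := 0) zero_le_one u) (Icc 0 2)
  contDiffOn_two : ContDiffOn ℝ 2 (curveIn (s := -1) (by norm_num) u) (Icc 0 2)
  initial : u 0 = u₀
  initial_deriv : (timeDeriv (s := 0) zero_le_one 1 u 0).toDist = (u₁ : 𝓢'(Rn n, ℂ))
  equation : ∀ t ∈ Icc (0 : ℝ) 2,
    (timeDeriv (s := -1) (by norm_num) 2 u t).toDist - Δ (u t).toDist
      + (d t : ℂ) • (timeDeriv (s := 0) zero_le_one 1 u t).toDist = 0

theorem neg_natCast_le_one (k : ℕ) : -(k : ℝ) ≤ 1 := by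
  have : (0 : ℝ) ≤ k := k.cast_nonneg
  linarith

theorem one_sub_natCast_le_one (k : ℕ) : 1 - (k : ℝ) ≤ 1 := by
  have : (0 : ℝ) ≤ k := k.cast_nonneg
  linarith

/-- `u ∈ C^{1+k}([0,2]; H^{-k}) ∩ C^k([0,2]; H^{1-k})`. -/
def HasEnergyRegularity {n : ℕ} (k : ℕ) (u : ℝ → Sobolev n 1) : Prop :=
  ContDiffOn ℝ (1 + k : ℕ) (curveIn (neg_natCast_le_one k) u) (Icc 0 2) ∧
  ContDiffOn ℝ k (curveIn (one_sub_natCast_le_one k) u) (Icc 0 2)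

/-- `‖∂_t^{1+k} u(t)‖_{H^{-k}} + ‖∂_t^k u(t)‖_{H^{1-k}}`. -/
def energyNorm {n : ℕ} (k : ℕ) (u : ℝ → Sobolev n 1) (t : ℝ) : ℝ :=
  ‖timeDeriv (neg_natCast_le_one k) (1 + k) u t‖ + ‖timeDeriv (one_sub_natCast_le_one k) k u t‖

/-- The net `ε ↦ d_ε` of coefficients is moderate on `[0,2]`: the `d_ε` are smooth and
`sup_t |∂_t^k d_ε(t)| = O(ε^{N-k})` for some `N`. -/
def IsModerateCoefficient (d : ℝ → ℝ → ℝ) : Prop :=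
  (∀ ε ∈ Ioc (0 : ℝ) 1, ContDiffOn ℝ ∞ (d ε) (Icc 0 2)) ∧
  ∃ N : ℝ, ∀ k : ℕ, ∃ C : ℝ, ∀ ε ∈ Ioc (0 : ℝ) 1, ∀ t ∈ Icc (0 : ℝ) 2,
    |iteratedDerivWithin k (d ε) (Icc 0 2) t| ≤ C * ε ^ (N - k)

/-- The net `ε ↦ u_ε` is moderate of energy type: for every `k` it has the time regularity of
finite energy solutions and `sup_t (‖∂_t^{1+k} u_ε‖_{H^{-k}} + ‖∂_t^k u_ε‖_{H^{1-k}}) = O(ε^{N-k})`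
for some `N`. -/
def IsModerateEnergyNet {n : ℕ} (u : ℝ → ℝ → Sobolev n 1) : Prop :=
  (∀ k : ℕ, ∀ ε ∈ Ioc (0 : ℝ) 1, HasEnergyRegularity k (u ε)) ∧
  ∃ N : ℝ, ∀ k : ℕ, ∃ C : ℝ, ∀ ε ∈ Ioc (0 : ℝ) 1, ∀ t ∈ Icc (0 : ℝ) 2,
    energyNorm k (u ε) t ≤ C * ε ^ (N - k)

/-- The net `ε ↦ u_ε`, `ε ∈ (0,1]`, is a very weak solution of energy type of the singular Cauchy
problem whose dissipation coefficient is regularised by the net `ε ↦ d_ε`. -/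
structure IsVeryWeakSolution {n : ℕ} (d : ℝ → ℝ → ℝ) (u₀ : Sobolev n 1) (u₁ : L2 n)
    (u : ℝ → ℝ → Sobolev n 1) : Prop where
  moderate_coefficient : IsModerateCoefficient d
  solution : ∀ ε ∈ Ioc (0 : ℝ) 1, IsEnergySolution (d ε) u₀ u₁ (u ε)
  moderate : IsModerateEnergyNet u

end

/-! The Fourier transform in x decouples the equation into damped oscillators y'' + l y + d(t) y' =
0 with l = |2πξ|² and d = b_ε'/b_ε. The decisive point is that d is bounded in L¹(0,2) uniformly in
ε, although the available bound for its supremum is only of order ε⁻¹. Almost everywhere b = g +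
j·1_{(1,∞)} with g Lipschitz, so |b_ε'(t)| ≤ L + |j| ψ_ε(t - 1) (`HasJumpForm.abs_deriv_conv_le`),
while b_ε ≥ b₀. A Gronwall argument for y'² + (l + 1) y² therefore loses no power of ε
(`IsOscillator.energy_le`).

Higher time derivatives come from differentiating the oscillator equation. Since ∂_t^i d =
O(ε^{-1-i}) (`exists_logDeriv_bound`), every derivative costs at most one factor ⟨ξ⟩ and, from the
second one on, one factor ε⁻¹ (`exists_oscillator_bound`). The factors ⟨ξ⟩ are paid by lowering the
Sobolev index: ∂_t^m u is bounded in H^{1-m} by a multiple of ε^{-(m-1)} for m ≥ 1, and m = 1 + k is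
the asserted rate.

A solution is built by using the fundamental solutions of the oscillators as Fourier multipliers on
the data; dominated convergence makes it differentiable in time (`hasDerivWithinAt_mulL`,
`IsWaveFamily.isEnergySolution`). Uniqueness (`IsEnergySolution.eqOn`) follows by cutting off high
frequencies, which leaves a linear ODE with bounded operators on L² × L². Hence the bounds for the
explicit solution hold for every solution. -/

noncomputable section Fourier

/-! ### Multiplication operators on L² and the weights ⟨ξ⟩^s. -/

open Filter Topology

/-- `m` is measurable and bounded. -/
def IsBddMeas {n : ℕ} (m : Rn n → ℝ) : Prop := Measurable m ∧ ∃ C : ℝ, ∀ ξ, |m ξ| ≤ C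

theorem IsBddMeas.memLp {n : ℕ} {m : Rn n → ℝ} (hm : IsBddMeas m) (f : L2 n) :
    MemLp (fun ξ => (m ξ : ℂ) * f ξ) 2 volume := by
  obtain ⟨h1, C, hC⟩ := hm
  refine MemLp.of_le_mul (c := C) (Lp.memLp f)
    ((Complex.measurable_ofReal.comp h1).aestronglyMeasurable.mul (Lp.aestronglyMeasurable f))
    (Eventually.of_forall fun ξ => ?_)
  rw [norm_mul, Complex.norm_real, Real.norm_eq_abs]
  exact mul_le_mul_of_nonneg_right (hC ξ) (norm_nonneg _)

/-- Multiplication of `L²` functions by a bounded measurable function, as a linear map. -/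
def IsBddMeas.mulLM {n : ℕ} {m : Rn n → ℝ} (hm : IsBddMeas m) : L2 n →ₗ[ℂ] L2 n where
  toFun f := (hm.memLp f).toLp _
  map_add' f g := by
    apply Lp.ext
    filter_upwards [(hm.memLp (f + g)).coeFn_toLp, (hm.memLp f).coeFn_toLp,
      (hm.memLp g).coeFn_toLp, Lp.coeFn_add f g,
      Lp.coeFn_add ((hm.memLp f).toLp _) ((hm.memLp g).toLp _)] with ξ h1 h2 h3 h4 h5
    rw [h1, h5, Pi.add_apply, h2, h3, h4, Pi.add_apply, mul_add]
  map_smul' c f := by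
    apply Lp.ext
    filter_upwards [(hm.memLp (c • f)).coeFn_toLp, (hm.memLp f).coeFn_toLp,
      Lp.coeFn_smul c f, Lp.coeFn_smul c ((hm.memLp f).toLp _)] with ξ h1 h2 h3 h4
    rw [h1, RingHom.id_apply, h4, Pi.smul_apply, h2, h3, Pi.smul_apply, smul_eq_mul,
      smul_eq_mul]
    ring

theorem IsBddMeas.mulLM_ae {n : ℕ} {m : Rn n → ℝ} (hm : IsBddMeas m) (f : L2 n) :
    ∀ᵐ ξ, hm.mulLM f ξ = (m ξ : ℂ) * f ξ :=
  (hm.memLp f).coeFn_toLp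

open Classical in
/-- Multiplication of `L²` functions by a bounded measurable function `m`. -/
def mulL {n : ℕ} (m : Rn n → ℝ) : L2 n →L[ℂ] L2 n :=
  -- The value 0 for other symbols allows time-dependent families `mulL (m t)` to be written for all
  -- t, although boundedness is known only for t in [0,2].
  if hm : IsBddMeas m then
    hm.mulLM.mkContinuous hm.2.choose fun f => by
      apply Lp.norm_le_mul_norm_of_ae_le_mul
      filter_upwards [hm.mulLM_ae f] with ξ h1
      rw [h1, norm_mul, Complex.norm_real, Real.norm_eq_abs]
      exact mul_le_mul_of_nonneg_right (hm.2.choose_spec ξ) (norm_nonneg _)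
  else 0

variable {n : ℕ} {s s' : ℝ}

theorem mulL_ae {m : Rn n → ℝ} (hm : IsBddMeas m) (f : L2 n) :
    ∀ᵐ ξ, mulL m f ξ = (m ξ : ℂ) * f ξ := by
  rw [mulL, dif_pos hm]
  exact hm.mulLM_ae f

theorem norm_mulL_le {m : Rn n → ℝ} (hm : IsBddMeas m) {C : ℝ} (hC : ∀ ξ, |m ξ| ≤ C) (f : L2 n) :
    ‖mulL m f‖ ≤ C * ‖f‖ := by
  apply Lp.norm_le_mul_norm_of_ae_le_mul
  filter_upwards [mulL_ae hm f] with ξ h1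
  rw [h1, norm_mul, Complex.norm_real, Real.norm_eq_abs]
  exact mul_le_mul_of_nonneg_right (hC ξ) (norm_nonneg _)

theorem IsBddMeas.mul {m m' : Rn n → ℝ} (hm : IsBddMeas m) (hm' : IsBddMeas m') :
    IsBddMeas (fun ξ => m ξ * m' ξ) := by
  obtain ⟨h1, C, hC⟩ := hm
  obtain ⟨h2, C', hC'⟩ := hm'
  refine ⟨h1.mul h2, C * C', fun ξ => ?_⟩
  rw [abs_mul]
  exact mul_le_mul (hC ξ) (hC' ξ) (abs_nonneg _) ((abs_nonneg _).trans (hC ξ))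

theorem mulL_mulL {m m' : Rn n → ℝ} (hm : IsBddMeas m) (hm' : IsBddMeas m') (f : L2 n) :
    mulL m (mulL m' f) = mulL (fun ξ => m ξ * m' ξ) f := by
  apply Lp.ext
  filter_upwards [mulL_ae hm (mulL m' f), mulL_ae hm' f, mulL_ae (hm.mul hm') f] with ξ h1 h2 h3
  rw [h1, h2, h3]
  push_cast
  ring

theorem mulL_one (f : L2 n) : mulL (fun _ => 1) f = f := by
  apply Lp.ext
  filter_upwards [mulL_ae (m := fun _ : Rn n => (1 : ℝ)) ⟨measurable_const, 1, by simp⟩ f]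
    with ξ h1
  rw [h1]
  simp

/-- A multiplication operator by a bounded function of temperate growth agrees with the
multiplication of tempered distributions. -/
theorem toDist_mulL {m : Rn n → ℝ} (hm : IsBddMeas m)
    (hg : Function.HasTemperateGrowth (fun ξ => (m ξ : ℂ))) (f : L2 n) :
    ((mulL m f : L2 n) : 𝓢'(Rn n, ℂ)) =
      TemperedDistribution.smulLeftCLM ℂ (fun ξ => (m ξ : ℂ)) (f : 𝓢'(Rn n, ℂ)) := by
  have hmem : MemLp (fun ξ => (m ξ : ℂ)) ⊤ (volume : Measure (Rn n)) := by
    obtain ⟨h1, C, hC⟩ := hm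
    refine memLp_top_of_bound (Complex.measurable_ofReal.comp h1).aestronglyMeasurable C
      (Eventually.of_forall fun ξ => ?_)
    rw [Complex.norm_real, Real.norm_eq_abs]
    exact hC ξ
  rw [← Lp.toTemperedDistribution_smul_eq (r := 2) hg hmem f]
  congr 1
  apply Lp.ext
  filter_upwards [mulL_ae hm f, Lp.coeFn_lpSMul (r := 2) (hmem.toLp _) f, hmem.coeFn_toLp]
    with ξ h1 h2 h3
  rw [h1, h2, Pi.smul_apply', h3, smul_eq_mul]

/-- The weight `⟨ξ⟩^s = (1 + |ξ|²)^{s/2}`. -/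
def bracket (s : ℝ) (ξ : Rn n) : ℝ := (1 + ‖ξ‖ ^ 2) ^ (s / 2)

theorem bracket_pos (s : ℝ) (ξ : Rn n) : 0 < bracket s ξ := by
  unfold bracket; positivity

theorem bracket_mul (s s' : ℝ) (ξ : Rn n) : bracket s ξ * bracket s' ξ = bracket (s + s') ξ := by
  unfold bracket
  rw [← Real.rpow_add (by positivity)]
  congr 1; ring

theorem bracket_zero (ξ : Rn n) : bracket 0 ξ = 1 := by simp [bracket]

theorem bracket_two (ξ : Rn n) : bracket 2 ξ = 1 + ‖ξ‖ ^ 2 := by simp [bracket]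

theorem bracket_natCast (m : ℕ) (ξ : Rn n) : bracket m ξ = bracket 1 ξ ^ m := by
  unfold bracket
  rw [← Real.rpow_natCast ((1 + ‖ξ‖ ^ 2) ^ ((1 : ℝ) / 2)) m, ← Real.rpow_mul (by positivity)]
  congr 1; ring

theorem one_le_bracket (hs : 0 ≤ s) (ξ : Rn n) : 1 ≤ bracket s ξ :=
  Real.one_le_rpow (by nlinarith [norm_nonneg ξ]) (by linarith)

theorem bracket_le_one (hs : s ≤ 0) (ξ : Rn n) : bracket s ξ ≤ 1 :=
  Real.rpow_le_one_of_one_le_of_nonpos (by nlinarith [norm_nonneg ξ]) (by linarith)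

theorem measurable_bracket (s : ℝ) : Measurable (bracket s : Rn n → ℝ) := by
  unfold bracket
  fun_prop

theorem isBddMeas_bracket (hs : s ≤ 0) : IsBddMeas (bracket s : Rn n → ℝ) :=
  ⟨measurable_bracket s, 1, fun ξ => by
    rw [abs_of_pos (bracket_pos s ξ)]; exact bracket_le_one hs ξ⟩

/-- The symbol `|2πξ|²` of `-Δ`. -/
def laplaceSymbol (ξ : Rn n) : ℝ := (2 * Real.pi) ^ 2 * ‖ξ‖ ^ 2

theorem laplaceSymbol_nonneg (ξ : Rn n) : 0 ≤ laplaceSymbol ξ := by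
  unfold laplaceSymbol; positivity

theorem measurable_laplaceSymbol : Measurable (laplaceSymbol : Rn n → ℝ) := by
  unfold laplaceSymbol
  fun_prop

/-- The weight of the Bessel potential is (1 + |ξ|²)^{s/2}, without the 2π that enters the symbol of
-Δ; the constant (2π)² compares the two. -/
theorem laplaceSymbol_le (ξ : Rn n) : laplaceSymbol ξ ≤ (2 * Real.pi) ^ 2 * bracket 2 ξ := by
  rw [bracket_two, laplaceSymbol]
  gcongr
  linarith

/-- This is the symbol of -Δ : H¹ → H⁻¹ after both spaces are identified with L²: each
identification contributes a factor ⟨ξ⟩⁻¹. -/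
theorem isBddMeas_laplaceSymbol_mul_bracket :
    IsBddMeas (fun ξ : Rn n => laplaceSymbol ξ * bracket (-2) ξ) := by
  refine ⟨measurable_laplaceSymbol.mul (measurable_bracket _), (2 * Real.pi) ^ 2, fun ξ => ?_⟩
  rw [abs_of_nonneg (mul_nonneg (laplaceSymbol_nonneg ξ) (bracket_pos _ ξ).le)]
  calc _ ≤ (2 * Real.pi) ^ 2 * bracket 2 ξ * bracket (-2) ξ :=
        mul_le_mul_of_nonneg_right (laplaceSymbol_le ξ) (bracket_pos _ ξ).le
    _ = _ := by rw [mul_assoc, bracket_mul]; simp [bracket_zero]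

/-! ### Sobolev spaces on the Fourier side. -/

namespace Sobolev

open FourierTransform TemperedDistribution

theorem exists_bessel_eq (h : L2 n) : ∃ f : Sobolev n s, bessel f = h := by
  have hs : besselPotential (Rn n) ℂ s (besselPotential (Rn n) ℂ (-s) (h : 𝓢'(Rn n, ℂ))) = h := by
    simp
  refine ⟨⟨besselPotential (Rn n) ℂ (-s) (h : 𝓢'(Rn n, ℂ)), ⟨h, hs⟩⟩, ?_⟩
  apply L2_toDist_injective
  exact (besselFun_spec _).symm.trans hs

/-- The isometry `⟨D⟩^s` of `H^s` onto `L²`. -/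
def besselEquiv (n : ℕ) (s : ℝ) : Sobolev n s ≃ₗᵢ[ℂ] L2 n where
  toLinearEquiv := LinearEquiv.ofBijective bessel ⟨bessel_injective, exists_bessel_eq⟩
  norm_map' f := (norm_eq f).symm

/-- The isometry `f ↦ 𝓕 ⟨D⟩^s f` of `H^s` onto `L²`. -/
def ft (n : ℕ) (s : ℝ) : Sobolev n s ≃ₗᵢ[ℂ] L2 n :=
  (besselEquiv n s).trans (Lp.fourierTransformₗᵢ (Rn n) ℂ)

theorem ft_apply (f : Sobolev n s) : ft n s f = 𝓕 (besselFun f) := rfl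

/-- The bridge between the L² coordinate of f and its Fourier transform as a distribution.
Identities between coordinates in different H^s are reduced to it by injectivity of L² → 𝓢'. -/
theorem ft_spec (f : Sobolev n s) :
    ((ft n s f : L2 n) : 𝓢'(Rn n, ℂ)) =
      smulLeftCLM ℂ (fun ξ => (bracket s ξ : ℂ)) (𝓕 (toDist f)) := by
  rw [ft_apply, ← Lp.fourier_toTemperedDistribution_eq]
  rw [← besselFun_spec, fourier_besselPotential_eq_smulLeftCLM_fourier_apply]
  rfl

theorem hasTemperateGrowth_bracket (s : ℝ) :
    Function.HasTemperateGrowth (fun ξ : Rn n => (bracket s ξ : ℂ)) := by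
  unfold bracket
  fun_prop

theorem toDist_apply (f : Sobolev n s) : toDist f = Subtype.val f := rfl

theorem val_incl (h : s' ≤ s) (f : Sobolev n s) : Subtype.val (incl h f) = toDist f := by
  delta incl
  with_reducible rfl

theorem toDist_incl (h : s' ≤ s) (f : Sobolev n s) : toDist (incl h f) = toDist f :=
  (toDist_apply _).trans (val_incl h f)

theorem ft_incl (h : s' ≤ s) (f : Sobolev n s) :
    ft n s' (incl h f) = mulL (bracket (s' - s)) (ft n s f) := by
  have hb : (fun ξ : Rn n => (bracket s ξ : ℂ)) * (fun ξ => (bracket (s' - s) ξ : ℂ)) =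
      fun ξ => (bracket s' ξ : ℂ) := by
    ext ξ
    rw [Pi.mul_apply, ← Complex.ofReal_mul, bracket_mul, add_sub_cancel]
  apply L2_toDist_injective
  beta_reduce
  rw [toDist_mulL (isBddMeas_bracket (by linarith)) (hasTemperateGrowth_bracket _), ft_spec,
    ft_spec, smulLeftCLM_smulLeftCLM_apply (hasTemperateGrowth_bracket _)
      (hasTemperateGrowth_bracket _), toDist_incl, hb]

theorem ft_zero_of_toDist_eq {f : Sobolev n 0} {g : L2 n} (h : toDist f = (g : 𝓢'(Rn n, ℂ))) :
    ft n 0 f = 𝓕 g := by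
  apply L2_toDist_injective
  simp only
  rw [ft_spec, h, Lp.fourier_toTemperedDistribution_eq]
  simp only [bracket_zero, Complex.ofReal_one]
  simp

theorem toDist_eq_of_ft_zero {f : Sobolev n 0} {g : L2 n} (h : ft n 0 f = 𝓕 g) :
    toDist f = (g : 𝓢'(Rn n, ℂ)) := by
  have hg : besselPotential (Rn n) ℂ 0 (g : 𝓢'(Rn n, ℂ)) = g := by simp
  let g' : Sobolev n 0 := ⟨(g : 𝓢'(Rn n, ℂ)), ⟨g, hg⟩⟩
  have : f = g' := (ft n 0).injective (h.trans (ft_zero_of_toDist_eq rfl).symm)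
  rw [this]; rfl

/-- `-Δ : H¹ → H⁻¹`. -/
def negLaplacian (u : Sobolev n 1) : Sobolev n (-1) :=
  ⟨-Δ (toDist u), by
    have := (memSobolev u).laplacian.neg
    norm_num at this
    exact this⟩

theorem toDist_negLaplacian (u : Sobolev n 1) : toDist (negLaplacian u) = -Δ (toDist u) := rfl

theorem ft_negLaplacian (u : Sobolev n 1) :
    ft n (-1) (negLaplacian u) = mulL (fun ξ => laplaceSymbol ξ * bracket (-2) ξ) (ft n 1 u) := by
  have hg : Function.HasTemperateGrowth
      (fun ξ : Rn n => ((laplaceSymbol ξ * bracket (-2) ξ : ℝ) : ℂ)) := by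
    unfold laplaceSymbol bracket
    fun_prop
  apply L2_toDist_injective
  simp only
  have hl : Function.HasTemperateGrowth (fun ξ : Rn n => ((‖ξ‖ ^ 2 : ℝ) : ℂ)) := by fun_prop
  have h1 : 𝓕 (toDist (negLaplacian u)) = (((2 * Real.pi) ^ 2 : ℝ) : ℂ) •
      smulLeftCLM ℂ (fun ξ : Rn n => ((‖ξ‖ ^ 2 : ℝ) : ℂ)) (𝓕 (toDist u)) := by
    rw [toDist_negLaplacian, laplacian_eq_fourierMultiplierCLM, fourierMultiplierCLM_apply,
      ← Complex.coe_smul, ← neg_smul, fourier_smul, fourier_fourierInv_eq]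
    norm_num
  have h3 : (fun ξ : Rn n => (bracket 1 ξ : ℂ)) *
        (fun ξ => ((laplaceSymbol ξ * bracket (-2) ξ : ℝ) : ℂ)) =
      (((2 * Real.pi) ^ 2 : ℝ) : ℂ) •
        ((fun ξ => ((‖ξ‖ ^ 2 : ℝ) : ℂ)) * (fun ξ => (bracket (-1) ξ : ℂ))) := by
    ext ξ
    have h2 := bracket_mul 1 (-2) ξ
    norm_num at h2
    simp only [Pi.smul_apply, Pi.mul_apply, smul_eq_mul, laplaceSymbol, ← h2]
    push_cast
    ring
  rw [toDist_mulL isBddMeas_laplaceSymbol_mul_bracket hg, ft_spec, ft_spec,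
    smulLeftCLM_smulLeftCLM_apply (hasTemperateGrowth_bracket _) hg, h1,
    map_smul, smulLeftCLM_smulLeftCLM_apply hl (hasTemperateGrowth_bracket _), h3,
    smulLeftCLM_smul (hl.mul (hasTemperateGrowth_bracket _))]
  rfl

/-- All three terms are moved into H⁻¹, where `ft n (-1)` is injective. The weights record the loss
from H¹ (two orders, compensating the Laplacian) and from H⁰ (one order). -/
theorem equation_iff (f₂ : Sobolev n (-1)) (u : Sobolev n 1) (f₁ : Sobolev n 0) (d : ℝ) :
    toDist f₂ - Δ (toDist u) + (d : ℂ) • toDist f₁ = 0 ↔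
      ft n (-1) f₂ + mulL (fun ξ => laplaceSymbol ξ * bracket (-2) ξ) (ft n 1 u) +
        (d : ℂ) • mulL (bracket (-1)) (ft n 0 f₁) = 0 := by
  have h01 : (-1 : ℝ) ≤ 0 := by norm_num
  have h1 : toDist f₂ - Δ (toDist u) + (d : ℂ) • toDist f₁ =
      toDist (f₂ + negLaplacian u + (d : ℂ) • incl h01 f₁) := by
    rw [map_add, map_add, map_smul, toDist_incl, toDist_negLaplacian, sub_eq_add_neg]
  have h2 : mulL (bracket (-1)) (ft n 0 f₁) = ft n (-1) (incl h01 f₁) := by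
    rw [ft_incl, sub_zero]
  rw [h1, h2, ← ft_negLaplacian, ← map_smul, ← map_add, ← map_add,
    map_eq_zero_iff _ toDist_injective, map_eq_zero_iff _ (ft n (-1)).injective]

/-- The embedding `H^s ⊆ H^{s'}` as a continuous linear map. -/
def inclCLM (_h : s' ≤ s) : Sobolev n s →L[ℂ] Sobolev n s' :=
  ((ft n s').symm.toContinuousLinearEquiv : L2 n →L[ℂ] Sobolev n s') ∘L
    mulL (bracket (s' - s)) ∘L ((ft n s).toContinuousLinearEquiv : Sobolev n s →L[ℂ] L2 n)

theorem inclCLM_apply (h : s' ≤ s) (f : Sobolev n s) : inclCLM h f = incl h f := by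
  apply (ft n s').injective
  rw [ft_incl]
  exact (ft n s').apply_symm_apply _

end Sobolev

end Fourier

/-! ### Time-dependent multipliers: continuity and differentiability. -/

noncomputable section Curves

open Filter Topology

theorem norm_sq_L2 {n : ℕ} (f : L2 n) : ‖f‖ ^ 2 = ∫ ξ, ‖f ξ‖ ^ 2 := by
  have h := L2.inner_def (𝕜 := ℂ) f f
  have h1 : (inner ℂ f f : ℂ) = ((‖f‖ ^ 2 : ℝ) : ℂ) := by
    rw [inner_self_eq_norm_sq_to_K]; norm_cast
  have h2 : (∫ ξ, inner ℂ (f ξ) (f ξ) : ℂ) = ((∫ ξ, ‖f ξ‖ ^ 2 : ℝ) : ℂ) := by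
    rw [← integral_complex_ofReal]
    refine integral_congr_ae (Eventually.of_forall fun ξ => ?_)
    beta_reduce
    rw [inner_self_eq_norm_sq_to_K]; norm_cast
  rw [h1, h2] at h
  exact_mod_cast h

theorem integrable_norm_sq_L2 {n : ℕ} (f : L2 n) : Integrable (fun ξ => ‖f ξ‖ ^ 2) := by
  have := (Lp.memLp f).integrable_norm_rpow (by norm_num) (by norm_num)
  simpa using this

/-- Dominated convergence for multiplication operators. -/
theorem tendsto_mulL {n : ℕ} {ι : Type*} {l : Filter ι} [l.IsCountablyGenerated]
    {m : ι → Rn n → ℝ} {m₀ : Rn n → ℝ} {C : ℝ} (hm : ∀ᶠ i in l, Measurable (m i))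
    (hm₀ : IsBddMeas m₀) (hb : ∀ᶠ i in l, ∀ ξ, |m i ξ| ≤ C)
    (hlim : ∀ ξ, Tendsto (fun i => m i ξ) l (𝓝 (m₀ ξ))) (f : L2 n) :
    Tendsto (fun i => mulL (m i) f) l (𝓝 (mulL m₀ f)) := by
  obtain ⟨C₀, hC₀⟩ := hm₀.2
  rw [tendsto_iff_norm_sub_tendsto_zero]
  -- This integral is the squared distance of the two images of f; its integrand is dominated by a
  -- constant times |f|².
  have hsq : Tendsto (fun i => ∫ ξ, (m i ξ - m₀ ξ) ^ 2 * ‖f ξ‖ ^ 2) l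
      (𝓝 (∫ _ : Rn n, (0 : ℝ))) := by
    refine tendsto_integral_filter_of_dominated_convergence
      (fun ξ => (C + C₀) ^ 2 * ‖f ξ‖ ^ 2) ?_ ?_ ((integrable_norm_sq_L2 f).const_mul _) ?_
    · filter_upwards [hm] with i h
      exact ((h.sub hm₀.1).pow_const 2).aestronglyMeasurable.mul
        (integrable_norm_sq_L2 f).aestronglyMeasurable
    · filter_upwards [hb] with i h
      refine Eventually.of_forall fun ξ => ?_
      rw [Real.norm_eq_abs, abs_of_nonneg (by positivity)]
      refine mul_le_mul_of_nonneg_right (sq_le_sq' ?_ ?_) (by positivity)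
      · have h1 := abs_le.mp (h ξ); have h2 := abs_le.mp (hC₀ ξ); linarith
      · have h1 := abs_le.mp (h ξ); have h2 := abs_le.mp (hC₀ ξ); linarith
    · refine Eventually.of_forall fun ξ => ?_
      have h := (((hlim ξ).sub_const (m₀ ξ)).pow 2).mul_const (‖f ξ‖ ^ 2)
      simpa using h
  rw [integral_zero] at hsq
  have h0 := (Real.continuous_sqrt.tendsto 0).comp hsq
  rw [Real.sqrt_zero] at h0
  refine h0.congr' ?_
  filter_upwards [hm, hb] with i h1 h2
  rw [Function.comp_apply, Real.sqrt_eq_iff_eq_sq (by positivity) (norm_nonneg _),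
    norm_sq_L2]
  refine integral_congr_ae ?_
  filter_upwards [mulL_ae ⟨h1, C, h2⟩ f, mulL_ae hm₀ f, Lp.coeFn_sub (mulL (m i) f) (mulL m₀ f)]
    with ξ e1 e2 e3
  rw [e3, Pi.sub_apply, e1, e2, ← sub_mul, norm_mul, ← Complex.ofReal_sub, Complex.norm_real,
    Real.norm_eq_abs, mul_pow, sq_abs]

theorem mulL_sub_smul {n : ℕ} {m m' : Rn n → ℝ} (hm : IsBddMeas m) (hm' : IsBddMeas m') (c : ℝ)
    (f : L2 n) : c • (mulL m f - mulL m' f) = mulL (fun ξ => c * (m ξ - m' ξ)) f := by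
  have h : IsBddMeas (fun ξ => c * (m ξ - m' ξ)) := by
    obtain ⟨h1, C, hC⟩ := hm
    obtain ⟨h2, C', hC'⟩ := hm'
    refine ⟨(h1.sub h2).const_mul c, |c| * (C + C'), fun ξ => ?_⟩
    rw [abs_mul]
    exact mul_le_mul_of_nonneg_left ((abs_sub _ _).trans (add_le_add (hC ξ) (hC' ξ)))
      (abs_nonneg c)
  apply Lp.ext
  filter_upwards [mulL_ae hm f, mulL_ae hm' f, mulL_ae h f, Lp.coeFn_sub (mulL m f) (mulL m' f),
    Lp.coeFn_smul c (mulL m f - mulL m' f)] with ξ h1 h2 h3 h4 h5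
  rw [h5, Pi.smul_apply, h4, Pi.sub_apply, h1, h2, h3, Complex.real_smul]
  push_cast
  ring

/-- The difference quotients of the symbol converge pointwise and, by the mean value inequality on
the convex set S, are bounded by C' uniformly in ξ. So `tendsto_mulL` applies to them, without any
uniformity in ξ of the convergence. -/
theorem hasDerivWithinAt_mulL {n : ℕ} {m m' : ℝ → Rn n → ℝ} {S : Set ℝ} (hS : Convex ℝ S)
    {C C' : ℝ} (hm : ∀ t ∈ S, Measurable (m t)) (hm' : ∀ t ∈ S, Measurable (m' t))
    (hb : ∀ t ∈ S, ∀ ξ, |m t ξ| ≤ C) (hb' : ∀ t ∈ S, ∀ ξ, |m' t ξ| ≤ C')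
    (hd : ∀ ξ, ∀ t ∈ S, HasDerivWithinAt (fun t => m t ξ) (m' t ξ) S t) (f : L2 n)
    {t : ℝ} (ht : t ∈ S) :
    HasDerivWithinAt (fun t => mulL (m t) f) (mulL (m' t) f) S t := by
  rw [hasDerivWithinAt_iff_tendsto_slope]
  have hmem : ∀ᶠ r in 𝓝[S \ {t}] t, r ∈ S \ {t} := eventually_mem_nhdsWithin
  have hsl : (fun r => mulL (fun ξ => (r - t)⁻¹ * (m r ξ - m t ξ)) f) =ᶠ[𝓝[S \ {t}] t]
      slope (fun t => mulL (m t) f) t := by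
    filter_upwards [hmem] with r hr
    rw [slope_def_module, mulL_sub_smul ⟨hm r hr.1, C, hb r hr.1⟩ ⟨hm t ht, C, hb t ht⟩]
  refine Tendsto.congr' hsl (tendsto_mulL (C := C') ?_ ⟨hm' t ht, C', hb' t ht⟩ ?_ ?_ f)
  · filter_upwards [hmem] with r hr using ((hm r hr.1).sub (hm t ht)).const_mul _
  · filter_upwards [hmem] with r hr ξ
    have h1 := hS.norm_image_sub_le_of_norm_hasDerivWithin_le (hd ξ)
      (fun x hx => (Real.norm_eq_abs _).trans_le (hb' x hx ξ)) ht hr.1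
    rw [Real.norm_eq_abs, Real.norm_eq_abs] at h1
    rw [abs_mul, abs_inv, inv_mul_le_iff₀ (abs_pos.mpr (sub_ne_zero.mpr hr.2)), mul_comm]
    exact h1
  · intro ξ
    have h1 := hasDerivWithinAt_iff_tendsto_slope.mp (hd ξ t ht)
    refine h1.congr' (Eventually.of_forall fun r => ?_)
    rw [slope_def_module, smul_eq_mul]

/-- A chain of functions each of which is the derivative of the previous one. -/
theorem contDiffOn_of_chain {E : Type*} [NormedAddCommGroup E] [NormedSpace ℝ E] {S : Set ℝ}
    (hS : UniqueDiffOn ℝ S) {N : ℕ} {f : ℕ → ℝ → E}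
    (hc : ContinuousOn (f N) S)
    (hd : ∀ m < N, ∀ t ∈ S, HasDerivWithinAt (f m) (f (m + 1) t) S t) :
    ContDiffOn ℝ N (f 0) S ∧ ∀ m ≤ N, EqOn (iteratedDerivWithin m (f 0) S) (f m) S := by
  have h : ∀ m ≤ N, EqOn (iteratedDerivWithin m (f 0) S) (f m) S := by
    intro m
    induction m with
    | zero => intro _ t _; simp
    | succ m ih =>
      intro hm t ht
      rw [iteratedDerivWithin_succ, derivWithin_congr (ih (by omega)) (ih (by omega) ht)]
      exact (hd m (by omega) t ht).derivWithin (hS t ht)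
  refine ⟨?_, h⟩
  refine (contDiffOn_iff_continuousOn_differentiableOn_deriv hS).mpr ⟨fun m hm => ?_,
    fun m hm => ?_⟩
  · have hm' : m ≤ N := by exact_mod_cast hm
    refine ContinuousOn.congr ?_ (h m hm')
    rcases hm'.lt_or_eq with h1 | rfl
    · exact fun t ht => (hd m h1 t ht).continuousWithinAt
    · exact hc
  · have hm' : m < N := by exact_mod_cast hm
    exact DifferentiableOn.congr (fun t ht => (hd m hm' t ht).differentiableWithinAt) (h m hm'.le)

end Curves

/-! ### The damped oscillator: existence, smoothness and dependence on the frequency. -/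

noncomputable section Oscillator

open Filter Topology

/-- The vector field of the damped oscillator `y'' + l y + d(t) y' = 0`, as a first order system. -/
def oscField (d : ℝ → ℝ) (l t : ℝ) (z : ℝ × ℝ) : ℝ × ℝ := (z.2, -l * z.1 - d t * z.2)

theorem oscField_sub (d : ℝ → ℝ) (l t : ℝ) (z w : ℝ × ℝ) :
    oscField d l t z - oscField d l t w = oscField d l t (z - w) := by
  ext <;> simp [oscField]
  ring

theorem norm_oscField_le {d : ℝ → ℝ} {l t D : ℝ} (hD : |d t| ≤ D) (z : ℝ × ℝ) :
    ‖oscField d l t z‖ ≤ (1 + |l| + D) * ‖z‖ := by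
  have h1 : |z.1| ≤ ‖z‖ := norm_fst_le z
  have h2 : |z.2| ≤ ‖z‖ := norm_snd_le z
  have hD0 : 0 ≤ D := (abs_nonneg _).trans hD
  have h3 : |l| * |z.1| ≤ |l| * ‖z‖ := mul_le_mul_of_nonneg_left h1 (abs_nonneg l)
  have h4 : |d t| * |z.2| ≤ D * ‖z‖ := mul_le_mul hD h2 (abs_nonneg _) hD0
  have h5 : 0 ≤ |l| * ‖z‖ := by positivity
  have h6 : 0 ≤ D * ‖z‖ := by positivity
  rw [oscField, Prod.norm_mk, Real.norm_eq_abs, Real.norm_eq_abs]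
  refine max_le (by nlinarith [norm_nonneg z]) ?_
  have h7 := abs_sub (-l * z.1) (d t * z.2)
  rw [abs_mul, abs_mul, abs_neg] at h7
  nlinarith [norm_nonneg z]

/-- The projection of the plane onto the square `[-R, R]²`. -/
def clip (R : ℝ) (z : ℝ × ℝ) : ℝ × ℝ := (max (-R) (min R z.1), max (-R) (min R z.2))

theorem norm_clip_sub_le (R : ℝ) (z w : ℝ × ℝ) : ‖clip R z - clip R w‖ ≤ ‖z - w‖ := by
  have h : ∀ x y : ℝ, |max (-R) (min R x) - max (-R) (min R y)| ≤ |x - y| := fun x y => by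
    rw [max_comm (-R) (min R x), max_comm (-R) (min R y)]
    refine (abs_max_sub_max_le_abs _ _ _).trans ?_
    rw [min_comm R x, min_comm R y]
    exact abs_inf_sub_inf_le_abs _ _ _
  rw [Prod.norm_def, Prod.norm_def]
  exact max_le_max (h _ _) (h _ _)

theorem norm_clip_le {R : ℝ} (hR : 0 ≤ R) (z : ℝ × ℝ) : ‖clip R z‖ ≤ R := by
  have h : ∀ x : ℝ, |max (-R) (min R x)| ≤ R := fun x =>
    abs_le.mpr ⟨le_max_left _ _, max_le (by linarith) (min_le_left _ _)⟩
  rw [Prod.norm_def]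
  exact max_le (h _) (h _)

theorem clip_eq {R : ℝ} {z : ℝ × ℝ} (hz : ‖z‖ ≤ R) : clip R z = z := by
  have h1 := abs_le.mp ((norm_fst_le z).trans hz)
  have h2 := abs_le.mp ((norm_snd_le z).trans hz)
  ext
  · simp [clip, h1.1, h1.2]
  · simp [clip, h2.1, h2.2]

theorem norm_clip_le_norm {R : ℝ} (hR : 0 ≤ R) (z : ℝ × ℝ) : ‖clip R z‖ ≤ ‖z‖ := by
  have h := norm_clip_sub_le R z 0
  rwa [clip_eq (z := 0) (by simpa using hR), sub_zero, sub_zero] at h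

theorem HasDerivWithinAt.Ici_of_Icc {E : Type*} [NormedAddCommGroup E] [NormedSpace ℝ E]
    {f : ℝ → E} {f' : E} {a b t : ℝ} (h : HasDerivWithinAt f f' (Icc a b) t) (ht : t ∈ Ico a b) :
    HasDerivWithinAt f f' (Ici t) t :=
  h.mono_of_mem_nhdsWithin (Icc_mem_nhdsGE_of_mem ht)

/-- A linear field is unbounded, so Picard–Lindelöf by itself yields only short times. Clipping its
argument to the square of side 2R bounds the field by K R and gives a solution on all of [0,2].
Gronwall then keeps the solution inside the square, where clipping changes nothing. -/
theorem exists_oscField_solution {d : ℝ → ℝ} (hd : Continuous d) (l : ℝ) (x₀ : ℝ × ℝ) :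
    ∃ Y : ℝ → ℝ × ℝ, Y 0 = x₀ ∧
      ∀ t ∈ Icc (0 : ℝ) 2, HasDerivWithinAt Y (oscField d l t (Y t)) (Icc 0 2) t := by
  obtain ⟨D, hD⟩ := isCompact_Icc.exists_bound_of_continuousOn (hd.continuousOn (s := Icc 0 2))
  have hD' : ∀ t ∈ Icc (0 : ℝ) 2, |d t| ≤ D := hD
  have hD0 : 0 ≤ D := (abs_nonneg _).trans (hD' 0 (by simp))
  set K : ℝ := 1 + |l| + D with hK
  have hK0 : 0 ≤ K := by positivity
  -- The Gronwall bound at time 2 for growth rate K.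
  set R : ℝ := ‖x₀‖ * Real.exp (K * 2) with hR
  have hR0 : 0 ≤ R := by positivity
  have hbound : ∀ t ∈ Icc (0 : ℝ) 2, ∀ z, ‖oscField d l t (clip R z)‖ ≤ K * ‖z‖ := fun t ht z =>
    (norm_oscField_le (hD' t ht) _).trans
      (mul_le_mul_of_nonneg_left (norm_clip_le_norm hR0 z) hK0)
  have hPL : IsPicardLindelof (fun t z => oscField d l t (clip R z))
      (⟨0, by simp⟩ : Icc (0 : ℝ) 2) x₀ (⟨2 * (K * R), by positivity⟩) 0
      ⟨K * R, by positivity⟩ ⟨K, hK0⟩ := by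
    constructor
    · intro t ht
      refine LipschitzOnWith.of_dist_le_mul fun z _ w _ => ?_
      rw [dist_eq_norm, dist_eq_norm, oscField_sub]
      exact (norm_oscField_le (hD' t ht) _).trans
        (mul_le_mul_of_nonneg_left (norm_clip_sub_le R z w) hK0)
    · intro z _
      unfold oscField
      fun_prop
    · intro t ht z _
      exact (norm_oscField_le (hD' t ht) _).trans
        (mul_le_mul_of_nonneg_left (norm_clip_le hR0 z) hK0)
    · simp only [sub_zero, NNReal.coe_zero, max_eq_left (zero_le_two (α := ℝ))]
      exact (mul_comm _ _).le
  obtain ⟨Y, hY0, hY⟩ := hPL.exists_eq_forall_mem_Icc_hasDerivWithinAt₀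
  have hY0' : Y 0 = x₀ := hY0
  refine ⟨Y, hY0', fun t ht => ?_⟩
  have hle : ∀ t ∈ Icc (0 : ℝ) 2, ‖Y t‖ ≤ R := by
    intro t ht
    have h := norm_le_gronwallBound_of_norm_deriv_right_le (δ := ‖x₀‖) (K := K) (ε := 0)
      (fun t ht => (hY t ht).continuousWithinAt)
      (fun t ht => (hY t (Ico_subset_Icc_self ht)).Ici_of_Icc ht) (by rw [hY0'])
      (fun t ht => by
        rw [add_zero]; exact hbound t (Ico_subset_Icc_self ht) _) t ht
    rw [gronwallBound_ε0, sub_zero] at h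
    refine h.trans ?_
    rw [hR]
    gcongr
    exact ht.2
  have h := hY t ht
  rwa [clip_eq (hle t ht)] at h

/-- The difference of the solutions for l and μ solves the equation for l with a source of size |l -
μ| times the solution for μ, and starts at 0; Gronwall makes it small. Continuity in l is what later
makes the multipliers measurable in ξ. -/
theorem continuous_oscField_solution {d : ℝ → ℝ} (hd : Continuous d) {x₀ : ℝ × ℝ}
    {Y : ℝ → ℝ → ℝ × ℝ} (h0 : ∀ l, Y l 0 = x₀)
    (hY : ∀ l, ∀ t ∈ Icc (0 : ℝ) 2, HasDerivWithinAt (Y l) (oscField d l t (Y l t)) (Icc 0 2) t)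
    {t : ℝ} (ht : t ∈ Icc (0 : ℝ) 2) : Continuous (fun l => Y l t) := by
  obtain ⟨D, hD⟩ := isCompact_Icc.exists_bound_of_continuousOn (hd.continuousOn (s := Icc 0 2))
  have hD' : ∀ t ∈ Icc (0 : ℝ) 2, |d t| ≤ D := hD
  rw [continuous_iff_continuousAt]
  intro μ
  have hYc : ∀ l, ContinuousOn (Y l) (Icc 0 2) := fun l t ht => (hY l t ht).continuousWithinAt
  obtain ⟨B, hB⟩ := isCompact_Icc.exists_bound_of_continuousOn (hYc μ)
  set K : ℝ := 1 + (|μ| + 1) + D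
  have key : ∀ᶠ l in 𝓝 μ, ‖Y l t - Y μ t‖ ≤ gronwallBound 0 K (|l - μ| * B) t := by
    filter_upwards [Metric.ball_mem_nhds μ one_pos] with l hl
    rw [Metric.mem_ball, Real.dist_eq] at hl
    have hl' : |l| ≤ |μ| + 1 := by
      have := abs_sub_abs_le_abs_sub l μ; linarith
    have h := norm_le_gronwallBound_of_norm_deriv_right_le (δ := 0) (K := K) (ε := |l - μ| * B)
      (f := fun t => Y l t - Y μ t) ((hYc l).sub (hYc μ))
      (fun t ht => ((hY l t (Ico_subset_Icc_self ht)).Ici_of_Icc ht).sub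
        ((hY μ t (Ico_subset_Icc_self ht)).Ici_of_Icc ht)) (by simp [h0]) (fun t ht => ?_) t ht
    · rwa [sub_zero] at h
    · have ht' := Ico_subset_Icc_self ht
      have e : oscField d l t (Y l t) - oscField d μ t (Y μ t) =
          oscField d l t (Y l t - Y μ t) + (0, -(l - μ) * (Y μ t).1) := by
        ext <;> simp [oscField]
        ring
      rw [e]
      refine (norm_add_le _ _).trans (add_le_add ?_ ?_)
      · refine (norm_oscField_le (hD' t ht') _).trans
          (mul_le_mul_of_nonneg_right ?_ (norm_nonneg _))
        simp only [K]; linarith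
      · rw [Prod.norm_mk, norm_zero, max_eq_right (norm_nonneg _), norm_mul, norm_neg,
          Real.norm_eq_abs]
        exact mul_le_mul_of_nonneg_left ((norm_fst_le _).trans (hB t ht')) (abs_nonneg _)
  rw [ContinuousAt, tendsto_iff_norm_sub_tendsto_zero]
  refine squeeze_zero' (Eventually.of_forall fun _ => norm_nonneg _) key ?_
  have hc : Continuous (fun l => gronwallBound 0 K (|l - μ| * B) t) :=
    (gronwallBound_continuous_ε 0 K t).comp (by fun_prop)
  have := hc.tendsto μ
  simpa [gronwallBound_ε0_δ0] using this

/-- The family `J l m = ∂_t^m y`, `m ∈ ℕ`, for the solution `y` on `[0,2]` of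
`y'' + l y + d(t) y' = 0` with `y(0) = p`, `y'(0) = q`. -/
structure IsOscillator (d : ℝ → ℝ) (p q : ℝ) (J : ℝ → ℕ → ℝ → ℝ) : Prop where
  hasDerivWithinAt : ∀ l m, ∀ t ∈ Icc (0 : ℝ) 2,
    HasDerivWithinAt (J l m) (J l (m + 1) t) (Icc 0 2) t
  initial : ∀ l, J l 0 0 = p
  initial_deriv : ∀ l, J l 1 0 = q
  recursion : ∀ l k, ∀ t ∈ Icc (0 : ℝ) 2, J l (k + 2) t = -l * J l k t -
    ∑ i ∈ Finset.range (k + 1), (k.choose i : ℝ) * iteratedDeriv i d t * J l (k - i + 1) t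
  continuous : ∀ m, ∀ t ∈ Icc (0 : ℝ) 2, Continuous (fun l => J l m t)

/-- A solution of an ODE with smooth field is smooth, and Leibniz' rule applied to y'' = -l y - d y'
gives the recursion. The recursion also carries continuity in l from orders 0 and 1 to all orders.
-/
theorem exists_isOscillator {d : ℝ → ℝ} (hd : ContDiff ℝ ∞ d) (p q : ℝ) :
    ∃ J, IsOscillator d p q J := by
  have hU : UniqueDiffOn ℝ (Icc (0 : ℝ) 2) := uniqueDiffOn_Icc (by norm_num)
  choose Y hY0 hY using fun l => exists_oscField_solution hd.continuous l (p, q)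
  have hsm : ∀ l, ContDiffOn ℝ ∞ (Y l) (Icc 0 2) := by
    intro l
    refine ODE.contDiffOn_enat_Icc_of_hasDerivWithinAt (n := ⊤) (f := oscField d l) (u := univ)
      ?_ (hY l) (mapsTo_univ _ _)
    have : ContDiff ℝ ∞ (Function.uncurry (oscField d l)) := by
      unfold oscField Function.uncurry
      fun_prop
    exact this.contDiffOn
  set y : ℝ → ℝ → ℝ := fun l t => (Y l t).1 with hy
  set J : ℝ → ℕ → ℝ → ℝ := fun l m => iteratedDerivWithin m (y l) (Icc 0 2) with hJ
  have hys : ∀ l, ContDiffOn ℝ ∞ (y l) (Icc 0 2) := fun l => contDiff_fst.comp_contDiffOn (hsm l)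
  have hder : ∀ l m, ∀ t ∈ Icc (0 : ℝ) 2,
      HasDerivWithinAt (J l m) (J l (m + 1) t) (Icc 0 2) t := by
    intro l m t ht
    simp only [hJ]
    rw [iteratedDerivWithin_succ]
    exact (((hys l).differentiableOn_iteratedDerivWithin
      (by exact_mod_cast WithTop.coe_lt_coe.mpr (WithTop.coe_lt_top m)) hU) t ht).hasDerivWithinAt
  have hJ1 : ∀ l, EqOn (derivWithin (y l) (Icc 0 2)) (fun t => (Y l t).2) (Icc 0 2) :=
    fun l t ht => by
    have h : HasDerivWithinAt (y l) (Y l t).2 (Icc 0 2) t :=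
      (hasFDerivAt_fst (𝕜 := ℝ) (p := Y l t)).comp_hasDerivWithinAt t (hY l t ht)
    exact h.derivWithin (hU t ht)
  have hJ2 : ∀ l, EqOn (derivWithin (derivWithin (y l) (Icc 0 2)) (Icc 0 2))
      (fun t => -l * y l t - d t * derivWithin (y l) (Icc 0 2) t) (Icc 0 2) := by
    intro l t ht
    beta_reduce
    rw [derivWithin_congr (hJ1 l) (hJ1 l ht), hJ1 l ht]
    exact (hasFDerivAt_snd.comp_hasDerivWithinAt t (hY l t ht)).derivWithin (hU t ht)
  have hrec : ∀ l k, ∀ t ∈ Icc (0 : ℝ) 2, J l (k + 2) t = -l * J l k t -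
      ∑ i ∈ Finset.range (k + 1), (k.choose i : ℝ) * iteratedDeriv i d t * J l (k - i + 1) t := by
    intro l k t ht
    have hk : ((k : ℕ∞) : WithTop ℕ∞) ≤ ∞ := by exact_mod_cast le_top
    have hy' : ContDiffOn ℝ k (y l) (Icc 0 2) := (hys l).of_le hk
    have hy1 : ContDiffOn ℝ k (derivWithin (y l) (Icc 0 2)) (Icc 0 2) :=
      (hys l).derivWithin hU (by exact_mod_cast le_top)
    have hdk : ContDiff ℝ k d := hd.of_le hk
    simp only [hJ]
    rw [iteratedDerivWithin_succ', iteratedDerivWithin_succ',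
      iteratedDerivWithin_congr (hJ2 l) ht]
    have e1 : (fun t => -l * y l t - d t * derivWithin (y l) (Icc 0 2) t) =
      (fun t => -l * y l t) - (d * derivWithin (y l) (Icc 0 2)) := rfl
    have hm1 : ContDiffWithinAt ℝ k (fun t => -l * y l t) (Icc 0 2) t :=
      (contDiffOn_const.mul hy') t ht
    have hm2 : ContDiffWithinAt ℝ k (d * derivWithin (y l) (Icc 0 2)) (Icc 0 2) t :=
      (hdk.contDiffOn.mul hy1) t ht
    rw [e1, iteratedDerivWithin_sub ht hU hm1 hm2, iteratedDerivWithin_const_mul ht hU _ (hy' t ht),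
      iteratedDerivWithin_mul ht hU (hdk.contDiffOn t ht) (hy1 t ht)]
    congr 1
    refine Finset.sum_congr rfl fun i hi => ?_
    rw [iteratedDerivWithin_succ', iteratedDerivWithin_eq_iteratedDeriv hU
      (hd.contDiffAt.of_le (by exact_mod_cast le_top)) ht]
  have hcY : ∀ t ∈ Icc (0 : ℝ) 2, Continuous (fun l => Y l t) := fun t ht =>
    continuous_oscField_solution hd.continuous hY0 hY ht
  have hz : (0 : ℝ) ∈ Icc (0 : ℝ) 2 := by simp
  refine ⟨J, hder, fun l => ?_, fun l => ?_, hrec, ?_⟩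
  · simp [hJ, hy, hY0]
  · simp only [hJ]
    rw [iteratedDerivWithin_one, hJ1 l hz]
    beta_reduce
    rw [hY0]
  · intro m
    induction m using Nat.strong_induction_on with
    | _ m ih =>
      intro t ht
      match m with
      | 0 => simpa [hJ, hy] using (hcY t ht).fst
      | 1 =>
        have : (fun l => J l 1 t) = fun l => (Y l t).2 := by
          ext l
          simp only [hJ]
          rw [iteratedDerivWithin_one, hJ1 l ht]
        rw [this]
        exact continuous_snd.comp (hcY t ht)
      | k + 2 =>
        simp only [fun l => hrec l k t ht]
        refine (continuous_neg.mul (ih k (by omega) t ht)).sub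
          (continuous_finsetSum _ fun i hi => continuous_const.mul (ih _ ?_ t ht))
        omega

end Oscillator

/-! ### Bounds for the oscillator, uniform in frequency and regularisation. -/

noncomputable section OscillatorBounds

open Filter Topology

/-- Quantitative control on `[0,2]` of a smooth damping coefficient `d`: its `i`-th derivative is
at most `D i * e ^ (i + 1)`, and `|d|` has a continuous majorant of integral at most `A`. -/
structure DampingBound (A : ℝ) (D : ℕ → ℝ) (e : ℝ) (d : ℝ → ℝ) : Prop where
  contDiff : ContDiff ℝ ∞ d
  abs_iteratedDeriv_le : ∀ i, ∀ t ∈ Icc (0 : ℝ) 2, |iteratedDeriv i d t| ≤ D i * e ^ (i + 1)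
  exists_majorant : ∃ a : ℝ → ℝ, Continuous a ∧ (∀ t ∈ Icc (0 : ℝ) 2, |d t| ≤ a t) ∧
    ∫ t in (0 : ℝ)..2, a t ≤ A

variable {A κ e p q l w : ℝ} {D : ℕ → ℝ} {d : ℝ → ℝ} {J : ℝ → ℕ → ℝ → ℝ}

/-- For E = y'² + (l + 1) y² one has E' = 2 y y' - 2 d y'² ≤ (2a + 1) E, so E exp(-2∫a - t)
decreases. Only the integral of the majorant a enters, not the supremum of d. The extra y² keeps the
energy definite at l = 0 and accounts for the term 2 y y'. -/
theorem IsOscillator.energy_le (hJ : IsOscillator d p q J) (hd : DampingBound A D e d)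
    (hl : 0 ≤ l) {t : ℝ} (ht : t ∈ Icc (0 : ℝ) 2) :
    J l 1 t ^ 2 + (l + 1) * J l 0 t ^ 2 ≤
      Real.exp (2 * A + 2) * (q ^ 2 + (l + 1) * p ^ 2) := by
  obtain ⟨a, ha, hda, hA⟩ := hd.exists_majorant
  set E : ℝ → ℝ := fun t => J l 1 t ^ 2 + (l + 1) * J l 0 t ^ 2 with hE
  set P : ℝ → ℝ := fun t => 2 * (∫ r in (0 : ℝ)..t, a r) + t with hP
  have hPd : ∀ t, HasDerivAt P (2 * a t + 1) t := fun t =>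
    ((intervalIntegral.integral_hasDerivAt_right (ha.intervalIntegrable _ _)
      (ha.stronglyMeasurableAtFilter _ _) ha.continuousAt).const_mul 2).add (hasDerivAt_id t)
  have hEd : ∀ t ∈ Icc (0 : ℝ) 2, HasDerivWithinAt E
      (2 * J l 0 t * J l 1 t - 2 * d t * J l 1 t ^ 2) (Icc 0 2) t := by
    intro t ht
    have h0 := hJ.hasDerivWithinAt l 0 t ht
    have h1 := hJ.hasDerivWithinAt l 1 t ht
    have h2 := hJ.recursion l 0 t ht
    refine ((h1.pow 2).add ((h0.pow 2).const_mul (l + 1))).congr_deriv ?_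
    simp only [zero_add, Finset.range_one, Finset.sum_singleton, Nat.choose_self, Nat.cast_one,
      iteratedDeriv_zero, one_mul, Nat.sub_zero] at h2
    simp only [Nat.reduceAdd, h2]
    push_cast
    ring
  have hg : ∀ t ∈ Icc (0 : ℝ) 2, HasDerivWithinAt (fun t => E t * Real.exp (-P t))
      ((2 * J l 0 t * J l 1 t - 2 * d t * J l 1 t ^ 2) * Real.exp (-P t) +
        E t * (Real.exp (-P t) * -(2 * a t + 1))) (Icc 0 2) t := fun t ht =>
    (hEd t ht).mul (((hPd t).neg.exp).hasDerivWithinAt)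
  have hanti : AntitoneOn (fun t => E t * Real.exp (-P t)) (Icc 0 2) := by
    refine antitoneOn_of_hasDerivWithinAt_nonpos (convex_Icc 0 2)
      (fun t ht => (hg t ht).continuousWithinAt)
      (fun t ht => (hg t (interior_subset ht)).mono interior_subset) fun t ht => ?_
    have ht' := interior_subset ht
    have h1 : 2 * J l 0 t * J l 1 t - 2 * d t * J l 1 t ^ 2 ≤ (2 * a t + 1) * E t := by
      have h2 := abs_le.mp (hda t ht')
      have h3 : -d t * J l 1 t ^ 2 ≤ a t * J l 1 t ^ 2 :=
        mul_le_mul_of_nonneg_right (by linarith) (sq_nonneg _)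
      have ha0 : 0 ≤ a t := (abs_nonneg _).trans (hda t ht')
      have h4 : 0 ≤ a t * ((l + 1) * J l 0 t ^ 2) := by positivity
      have h5 : 0 ≤ l * J l 0 t ^ 2 := by positivity
      simp only [hE]
      nlinarith [sq_nonneg (J l 0 t - J l 1 t)]
    have h2 := mul_le_mul_of_nonneg_right h1 (Real.exp_pos (-P t)).le
    linarith
  have h := hanti (left_mem_Icc.mpr zero_le_two) ht ht.1
  have hP0 : P 0 = 0 := by simp [hP]
  have hPt : P t ≤ 2 * A + 2 := by
    have h1 : ∫ r in (0 : ℝ)..t, a r ≤ ∫ r in (0 : ℝ)..2, a r := by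
      refine intervalIntegral.integral_mono_interval le_rfl ht.1 ht.2 ?_
        (ha.intervalIntegrable _ _)
      filter_upwards [ae_restrict_mem measurableSet_Ioc] with r hr
      exact (abs_nonneg _).trans (hda r (Ioc_subset_Icc_self hr))
    simp only [hP]
    linarith [ht.2]
  have hE0 : E 0 = q ^ 2 + (l + 1) * p ^ 2 := by simp [hE, hJ.initial, hJ.initial_deriv]
  beta_reduce at h
  rw [hP0, neg_zero, Real.exp_zero, mul_one, hE0] at h
  calc E t = E t * Real.exp (-P t) * Real.exp (P t) := by
        rw [mul_assoc, ← Real.exp_add]; simp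
    _ ≤ (q ^ 2 + (l + 1) * p ^ 2) * Real.exp (P t) :=
        mul_le_mul_of_nonneg_right h (Real.exp_pos _).le
    _ ≤ (q ^ 2 + (l + 1) * p ^ 2) * Real.exp (2 * A + 2) :=
        mul_le_mul_of_nonneg_left (Real.exp_le_exp.mpr hPt) (by positivity)
    _ = _ := mul_comm _ _

/-- Here w plays the role of ⟨ξ⟩, with w² comparable to l + 1; the bounds are square roots of the
energy estimate. -/
theorem IsOscillator.abs_le_of_le_one (hJ : IsOscillator d p q J) (hd : DampingBound A D e d)
    (hl : 0 ≤ l) (hw : 1 ≤ w) (hwl : w ^ 2 ≤ l + 1) (hlw : l + 1 ≤ κ * w ^ 2)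
    {t : ℝ} (ht : t ∈ Icc (0 : ℝ) 2) :
    w * |J l 0 t| ≤ Real.exp (A + 1) * (1 + κ) * (w * |p| + |q|) ∧
      |J l 1 t| ≤ Real.exp (A + 1) * (1 + κ) * (w * |p| + |q|) := by
  have hE := hJ.energy_le hd hl ht
  have hκ : 0 ≤ κ := by
    by_contra! h
    nlinarith [mul_neg_of_neg_of_pos h (by positivity : 0 < w ^ 2)]
  have hexp : Real.exp (2 * A + 2) = Real.exp (A + 1) ^ 2 := by
    rw [← Real.exp_nat_mul]; congr 1; push_cast; ring
  have h1 : q ^ 2 + (l + 1) * p ^ 2 ≤ ((1 + κ) * (w * |p| + |q|)) ^ 2 := by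
    have h2 : (l + 1) * p ^ 2 ≤ κ * w ^ 2 * p ^ 2 :=
      mul_le_mul_of_nonneg_right hlw (sq_nonneg _)
    have h3 : 0 ≤ w * |p| * |q| := by positivity
    have h4 : (w * |p| + |q|) ^ 2 = w ^ 2 * p ^ 2 + q ^ 2 + 2 * (w * |p| * |q|) := by
      rw [add_sq, mul_pow, sq_abs, sq_abs]; ring
    rw [mul_pow, h4]
    have h5 : 0 ≤ w ^ 2 * p ^ 2 := by positivity
    have h6 : 0 ≤ q ^ 2 := sq_nonneg q
    nlinarith [mul_nonneg hκ h5, mul_nonneg hκ h6, mul_nonneg hκ h3,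
      mul_nonneg (mul_nonneg hκ hκ) h5, mul_nonneg (mul_nonneg hκ hκ) h6,
      mul_nonneg (mul_nonneg hκ hκ) h3]
  have h2 : J l 1 t ^ 2 + (l + 1) * J l 0 t ^ 2 ≤
      (Real.exp (A + 1) * (1 + κ) * (w * |p| + |q|)) ^ 2 := by
    rw [hexp] at hE
    rw [mul_assoc, mul_pow]
    exact hE.trans (mul_le_mul_of_nonneg_left h1 (sq_nonneg _))
  constructor
  · refine abs_le_of_sq_le_sq' ?_ (by positivity) |>.2
    rw [mul_pow, sq_abs]
    nlinarith [mul_le_mul_of_nonneg_right hwl (sq_nonneg (J l 0 t)), sq_nonneg (J l 1 t)]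
  · refine abs_le_of_sq_le_sq' ?_ (by positivity) |>.2
    rw [sq_abs]
    nlinarith [mul_nonneg (by linarith : 0 ≤ l + 1) (sq_nonneg (J l 0 t))]

/-- Bounds for all time derivatives of a damped oscillator, with constants that depend only on the
constants of the damping coefficient. -/
theorem exists_oscillator_bound (A κ : ℝ) (D : ℕ → ℝ) (hD : ∀ i, 0 ≤ D i) (hκ : 0 ≤ κ) (m : ℕ) :
    ∃ C : ℝ, 0 ≤ C ∧ ∀ (e l w p q : ℝ) (d : ℝ → ℝ) (J : ℝ → ℕ → ℝ → ℝ), 1 ≤ e →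
      DampingBound A D e d → IsOscillator d p q J → 0 ≤ l → 1 ≤ w → w ^ 2 ≤ l + 1 →
      l + 1 ≤ κ * w ^ 2 → ∀ t ∈ Icc (0 : ℝ) 2, ∀ j ≤ m,
        w * |J l j t| ≤ C * e ^ (j - 1) * w ^ j * (w * |p| + |q|) := by
  -- Orders 0 and 1 come from the energy and cost no power of e; the truncated exponent j - 1 is 0
  -- in both cases.
  have hbase : ∃ C : ℝ, 0 ≤ C ∧ ∀ (e l w p q : ℝ) (d : ℝ → ℝ) (J : ℝ → ℕ → ℝ → ℝ), 1 ≤ e →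
      DampingBound A D e d → IsOscillator d p q J → 0 ≤ l → 1 ≤ w → w ^ 2 ≤ l + 1 →
      l + 1 ≤ κ * w ^ 2 → ∀ t ∈ Icc (0 : ℝ) 2, ∀ j ≤ 1,
        w * |J l j t| ≤ C * e ^ (j - 1) * w ^ j * (w * |p| + |q|) := by
    refine ⟨Real.exp (A + 1) * (1 + κ), by positivity, ?_⟩
    intro e l w p q d J he hd hJ hl hw hwl hlw t ht j hj
    obtain ⟨h0, h1⟩ := hJ.abs_le_of_le_one hd hl hw hwl hlw ht
    interval_cases j
    · simpa using h0
    · have := mul_le_mul_of_nonneg_left h1 (by linarith : 0 ≤ w)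
      simp only [Nat.sub_self, pow_zero, pow_one, mul_one]
      linarith
  induction m with
  | zero =>
    obtain ⟨C, hC0, hC⟩ := hbase
    exact ⟨C, hC0, fun e l w p q d J h1 h2 h3 h4 h5 h6 h7 t ht j hj =>
      hC e l w p q d J h1 h2 h3 h4 h5 h6 h7 t ht j (by omega)⟩
  | succ m ih =>
    rcases Nat.eq_zero_or_pos m with rfl | hm
    · exact hbase
    obtain ⟨k, rfl⟩ : ∃ k, m = k + 1 := ⟨m - 1, by omega⟩
    obtain ⟨C, hC0, hC⟩ := ih
    set S : ℝ := ∑ i ∈ Finset.range (k + 1), (k.choose i : ℝ) * D i with hS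
    have hS0 : 0 ≤ S := Finset.sum_nonneg fun i _ => mul_nonneg (Nat.cast_nonneg _) (hD i)
    refine ⟨C + (κ * C + S * C), by positivity, ?_⟩
    intro e l w p q d J he hd hJ hl hw hwl hlw t ht j hj
    have hC' := hC e l w p q d J he hd hJ hl hw hwl hlw t ht
    set G : ℝ := w * |p| + |q| with hG
    have hG0 : 0 ≤ G := by positivity
    have he0 : 0 ≤ e := by linarith
    have hw0 : 0 ≤ w := by linarith
    rcases Nat.lt_or_ge j (k + 2) with hj' | hj'
    · refine (hC' j (by omega)).trans ?_
      gcongr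
      have : 0 ≤ κ * C + S * C := by positivity
      linarith
    obtain rfl : j = k + 2 := by omega
    set W : ℝ := C * (e ^ (k + 1) * (w ^ (k + 2) * G)) with hW
    have hW0 : 0 ≤ W := by positivity
    -- Here l costs w², exactly the two orders between k and k + 2; the power of e has room to
    -- spare.
    have t1 : l * (w * |J l k t|) ≤ κ * W := by
      have hlκ : l ≤ κ * w ^ 2 := by linarith
      calc l * (w * |J l k t|) ≤ κ * w ^ 2 * (C * e ^ (k - 1) * w ^ k * G) :=
            mul_le_mul hlκ (hC' k (by omega)) (by positivity) (by positivity)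
        _ ≤ κ * w ^ 2 * (C * e ^ (k + 1) * w ^ k * G) := by
            gcongr
            omega
        _ = _ := by rw [hW]; ring
    -- The powers of e add up exactly: i + 1 from the coefficient and k - i from the lower
    -- derivative. The power of w stays below k + 2, and w ≥ 1 fills the gap.
    have t2 : ∀ i ∈ Finset.range (k + 1),
        w * |(k.choose i : ℝ) * iteratedDeriv i d t * J l (k - i + 1) t| ≤
          (k.choose i : ℝ) * D i * W := by
      intro i hi
      have hi' : i ≤ k := by have := Finset.mem_range.mp hi; omega
      have h1 := hC' (k - i + 1) (by omega)
      rw [abs_mul, abs_mul, Nat.abs_cast]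
      calc w * ((k.choose i : ℝ) * |iteratedDeriv i d t| * |J l (k - i + 1) t|)
          = (k.choose i : ℝ) * (|iteratedDeriv i d t| * (w * |J l (k - i + 1) t|)) := by ring
        _ ≤ (k.choose i : ℝ) * ((D i * e ^ (i + 1)) *
            (C * e ^ (k - i + 1 - 1) * w ^ (k - i + 1) * G)) := by
            refine mul_le_mul_of_nonneg_left ?_ (Nat.cast_nonneg _)
            exact mul_le_mul (hd.abs_iteratedDeriv_le i t ht) h1 (by positivity)
              (mul_nonneg (hD i) (by positivity))
        _ = (k.choose i : ℝ) * D i * (C * (e ^ (k + 1) * (w ^ (k - i + 1) * G))) := by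
            have : e ^ (k + 1) = e ^ (i + 1) * e ^ (k - i + 1 - 1) := by
              rw [← pow_add]; congr 1; omega
            rw [this]; ring
        _ ≤ _ := by
            rw [hW]
            have := hD i
            gcongr
            · omega
            · norm_num
    have hrec := hJ.recursion l k t ht
    have t3 : |J l (k + 2) t| ≤ l * |J l k t| + ∑ i ∈ Finset.range (k + 1),
        |(k.choose i : ℝ) * iteratedDeriv i d t * J l (k - i + 1) t| := by
      rw [hrec]
      refine (abs_sub _ _).trans (add_le_add ?_ (Finset.abs_sum_le_sum_abs _ _))
      rw [abs_mul, abs_neg, abs_of_nonneg hl]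
    calc w * |J l (k + 2) t| ≤ l * (w * |J l k t|) + ∑ i ∈ Finset.range (k + 1),
          w * |(k.choose i : ℝ) * iteratedDeriv i d t * J l (k - i + 1) t| := by
          rw [← Finset.mul_sum]
          have := mul_le_mul_of_nonneg_left t3 hw0
          linarith
      _ ≤ κ * W + ∑ i ∈ Finset.range (k + 1), (k.choose i : ℝ) * D i * W :=
          add_le_add t1 (Finset.sum_le_sum t2)
      _ = κ * W + S * W := by rw [← Finset.sum_mul]
      _ ≤ W + (κ * W + S * W) := by linarith
      _ = _ := by
        rw [hW]
        have : k + 2 - 1 = k + 1 := by omega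
        rw [this]; ring

end OscillatorBounds

/-! ### Convolution of a function with a jump. -/

noncomputable section Regularisation

open Filter Topology

/-- A bounded measurable function with at most one jump, at `1`, in the form `g + j 1_{(1,∞)}`
with `g` Lipschitz continuous. -/
structure HasJumpForm (L M j : ℝ) (g β : ℝ → ℝ) : Prop where
  abs_sub_le : ∀ s t, |g s - g t| ≤ L * |s - t|
  abs_le : ∀ t, |g t| ≤ M
  eq : ∀ t, β t = g t + j * (Ioi (1 : ℝ)).indicator (fun _ => 1) t

theorem IsCbInfty.exists_bound {S : Set ℝ} {f : ℝ → ℝ} (hf : IsCbInfty S f) (hS : Convex ℝ S) :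
    ∃ L M : ℝ, (∀ t ∈ S, |f t| ≤ M) ∧
      ∀ s ∈ S, ∀ t ∈ S, |f s - f t| ≤ L * |s - t| := by
  obtain ⟨M, hM⟩ := hf.2 0
  obtain ⟨L, hL⟩ := hf.2 1
  refine ⟨L, M, fun t ht => by simpa using hM t ht, fun s hs t ht => ?_⟩
  refine hS.norm_image_sub_le_of_norm_derivWithin_le (f := f)
    (hf.1.differentiableOn (by simp)) (fun x hx => ?_) ht hs
  have := hL x hx
  rwa [iteratedDerivWithin_one] at this

theorem IsPiecewiseCbInfty.exists_hasJumpForm {b : ℝ → ℝ} (hb : IsPiecewiseCbInfty b) :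
    ∃ L M j : ℝ, ∃ g β : ℝ → ℝ, HasJumpForm L M j g β ∧ b =ᵐ[volume] β := by
  obtain ⟨bl, br, hl, hr, el, er⟩ := hb
  have hmin : ∀ t : ℝ, min t 1 ∈ Iic (1 : ℝ) := fun t => min_le_right t 1
  have hmax : ∀ t : ℝ, max t 1 ∈ Ici (1 : ℝ) := fun t => le_max_right t 1
  obtain ⟨L₁, M₁, hM₁, hL₁⟩ := hl.exists_bound (convex_Iic 1)
  obtain ⟨L₂, M₂, hM₂, hL₂⟩ := hr.exists_bound (convex_Ici 1)
  have hL₁0 : 0 ≤ L₁ := by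
    have := (abs_nonneg _).trans (hL₁ 1 (by simp) 0 (by simp)); simpa using this
  have hL₂0 : 0 ≤ L₂ := by
    have := (abs_nonneg _).trans (hL₂ 2 (by simp) 1 (by simp)); norm_num at this; exact this
  -- Each branch is frozen at its value at 1 beyond its half-line. On the left g equals `bl`; on the
  -- right it equals `br` minus the jump `br 1 - bl 1`.
  set g : ℝ → ℝ := fun s => bl (min s 1) + br (max s 1) - br 1 with hg
  refine ⟨L₁ + L₂, M₁ + M₂ + |br 1|, br 1 - bl 1, g,
    fun t => g t + (br 1 - bl 1) * (Ioi (1 : ℝ)).indicator (fun _ => 1) t,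
    ⟨fun s t => ?_, fun t => ?_, fun t => rfl⟩, ?_⟩
  · have h1 := hL₁ _ (hmin s) _ (hmin t)
    have h2 := hL₂ _ (hmax s) _ (hmax t)
    have h3 := mul_le_mul_of_nonneg_left (abs_inf_sub_inf_le_abs s t 1) hL₁0
    have h4 := mul_le_mul_of_nonneg_left (abs_max_sub_max_le_abs s t 1) hL₂0
    have e : g s - g t = (bl (min s 1) - bl (min t 1)) + (br (max s 1) - br (max t 1)) := by
      simp only [hg]; ring
    rw [e, add_mul]
    exact (abs_add_le _ _).trans (add_le_add (h1.trans h3) (h2.trans h4))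
  · simp only [hg]
    have h1 := hM₁ _ (hmin t)
    have h2 := hM₂ _ (hmax t)
    have h3 := abs_sub (bl (min t 1) + br (max t 1)) (br 1)
    have h4 := abs_add_le (bl (min t 1)) (br (max t 1))
    linarith
  · have h1 : ∀ᵐ t : ℝ, t ≠ 1 := by simp [ae_iff]
    filter_upwards [h1] with t ht
    rcases lt_or_gt_of_ne ht with h | h
    · simp [hg, el h, h.le, not_lt.mpr h.le]
    · simp [hg, er h, h.le, h]

variable {L M j : ℝ} {g β η : ℝ → ℝ}

theorem HasJumpForm.continuous (h : HasJumpForm L M j g β) : Continuous g := by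
  have hL : 0 ≤ L := by
    have := (abs_nonneg _).trans (h.abs_sub_le 1 0); simpa using this
  exact (LipschitzWith.of_dist_le_mul (K := ⟨L, hL⟩) fun s t => h.abs_sub_le s t).continuous

theorem HasJumpForm.measurable (h : HasJumpForm L M j g β) : Measurable β := by
  have : β = fun t => g t + j * (Ioi (1 : ℝ)).indicator (fun _ => 1) t := funext h.eq
  rw [this]
  exact h.continuous.measurable.add
    ((measurable_const.indicator measurableSet_Ioi).const_mul j)

theorem HasJumpForm.abs_le_add (h : HasJumpForm L M j g β) (t : ℝ) : |β t| ≤ M + |j| := by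
  rw [h.eq]
  refine (abs_add_le _ _).trans (add_le_add (h.abs_le t) ?_)
  rw [abs_mul]
  refine mul_le_of_le_one_right (abs_nonneg _) ?_
  by_cases ht : t ∈ Ioi (1 : ℝ) <;> simp [ht]

/-- The convolution of a bounded function with a test function. -/
def conv (β η : ℝ → ℝ) (t : ℝ) : ℝ := ∫ s, β s * η (t - s)

theorem conv_eq_convolution (β η : ℝ → ℝ) :
    conv β η = convolution β η (ContinuousLinearMap.mul ℝ ℝ) volume := rfl

theorem locallyIntegrable_of_bdd (hβ : Measurable β) (hM : ∀ t, |β t| ≤ M) :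
    LocallyIntegrable β := by
  refine LocallyIntegrable.mono (f := fun _ => M) (locallyIntegrable_const M)
    hβ.aestronglyMeasurable (Eventually.of_forall fun t => ?_)
  exact (hM t).trans (le_abs_self M)

theorem hasDerivAt_conv (hβ : Measurable β) (hM : ∀ t, |β t| ≤ M) (hη : ContDiff ℝ ∞ η)
    (hc : HasCompactSupport η) (t : ℝ) : HasDerivAt (conv β η) (conv β (deriv η) t) t := by
  rw [conv_eq_convolution, conv_eq_convolution]
  exact hc.hasDerivAt_convolution_right _ (locallyIntegrable_of_bdd hβ hM)
    (hη.of_le (by exact_mod_cast le_top)) t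

theorem contDiff_conv (hβ : Measurable β) (hM : ∀ t, |β t| ≤ M) (hη : ContDiff ℝ ∞ η)
    (hc : HasCompactSupport η) : ContDiff ℝ ∞ (conv β η) := by
  rw [conv_eq_convolution]
  exact hc.contDiff_convolution_right _ (locallyIntegrable_of_bdd hβ hM) hη

theorem contDiff_iteratedDeriv (hη : ContDiff ℝ ∞ η) (k : ℕ) :
    ContDiff ℝ ∞ (iteratedDeriv k η) := by
  induction k with
  | zero => simpa using hη
  | succ k ih =>
    rw [iteratedDeriv_succ]
    exact (contDiff_infty_iff_deriv.mp ih).2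

theorem hasCompactSupport_iteratedDeriv (hc : HasCompactSupport η) (k : ℕ) :
    HasCompactSupport (iteratedDeriv k η) := by
  induction k with
  | zero => simpa using hc
  | succ k ih => rw [iteratedDeriv_succ]; exact ih.deriv

theorem iteratedDeriv_conv (hβ : Measurable β) (hM : ∀ t, |β t| ≤ M) (hη : ContDiff ℝ ∞ η)
    (hc : HasCompactSupport η) (k : ℕ) :
    iteratedDeriv k (conv β η) = conv β (iteratedDeriv k η) := by
  induction k with
  | zero => simp
  | succ k ih =>
    rw [iteratedDeriv_succ, ih, iteratedDeriv_succ]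
    ext t
    exact (hasDerivAt_conv hβ hM (contDiff_iteratedDeriv hη k)
      (hasCompactSupport_iteratedDeriv hc k) t).deriv

theorem integrable_conv_integrand (hβ : Measurable β) (hM : ∀ t, |β t| ≤ M) (hη : Integrable η)
    (t : ℝ) : Integrable (fun s => β s * η (t - s)) :=
  (hη.comp_sub_left t).bdd_mul hβ.aestronglyMeasurable (Eventually.of_forall fun s => hM s)

theorem abs_conv_le (hM : ∀ t, |β t| ≤ M) (hη : Integrable η) (t : ℝ) :
    |conv β η t| ≤ M * ∫ s, |η s| := by
  have h1 : ‖∫ s, β s * η (t - s)‖ ≤ ∫ s, M * |η (t - s)| := by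
    refine norm_integral_le_of_norm_le (((hη.comp_sub_left t).abs).const_mul M)
      (Eventually.of_forall fun s => ?_)
    rw [norm_mul]
    exact mul_le_mul_of_nonneg_right (hM s) (abs_nonneg _)
  rw [integral_const_mul, integral_sub_left_eq_self (fun s => |η s|)] at h1
  exact h1

theorem le_conv {b₀ : ℝ} (hβ : Measurable β) (hM : ∀ t, |β t| ≤ M) (hb : ∀ᵐ t, b₀ ≤ β t)
    (hη : Integrable η) (hη0 : ∀ t, 0 ≤ η t) (hη1 : ∫ t, η t = 1) (t : ℝ) : b₀ ≤ conv β η t := by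
  have h1 : ∫ s, b₀ * η (t - s) = b₀ := by
    rw [integral_const_mul, integral_sub_left_eq_self η, hη1, mul_one]
  rw [← h1]
  refine integral_mono_ae ((hη.comp_sub_left t).const_mul b₀)
    (integrable_conv_integrand hβ hM hη t) ?_
  filter_upwards [hb] with s hs
  exact mul_le_mul_of_nonneg_right hs (hη0 _)

theorem conv_comm (t : ℝ) : conv β η t = ∫ r, β (t - r) * η r := by
  rw [conv, ← integral_sub_left_eq_self _ _ t]
  simp

/-- The derivative of the regularisation of a function with a jump. -/
theorem HasJumpForm.abs_deriv_conv_le (h : HasJumpForm L M j g β) (hη : ContDiff ℝ ∞ η)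
    (hc : HasCompactSupport η) (hη0 : ∀ t, 0 ≤ η t) (hη1 : ∫ t, η t = 1) (t : ℝ) :
    |deriv (conv β η) t| ≤ L + |j| * η (t - 1) := by
  have hint : Integrable η := hη.continuous.integrable_of_hasCompactSupport hc
  have hint' : Integrable (deriv η) :=
    (hη.continuous_deriv (by simp)).integrable_of_hasCompactSupport hc.deriv
  have hL : 0 ≤ L := by
    have := (abs_nonneg _).trans (h.abs_sub_le 1 0); simpa using this
  -- Averaging with a non-negative kernel of mass one preserves the Lipschitz constant.
  have h1 : |deriv (conv g η) t| ≤ L := by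
    refine norm_deriv_le_of_lipschitz (f := conv g η) (C := ⟨L, hL⟩)
      (LipschitzWith.of_dist_le_mul fun s t => ?_)
    have hi : ∀ x, Integrable (fun r => g (x - r) * η r) := fun x =>
      hint.bdd_mul (h.continuous.comp (by fun_prop)).aestronglyMeasurable
        (Eventually.of_forall fun r => h.abs_le (x - r))
    rw [Real.dist_eq, Real.dist_eq, conv_comm, conv_comm, ← integral_sub (hi s) (hi t)]
    have h2 : ‖∫ r, (g (s - r) * η r - g (t - r) * η r)‖ ≤ ∫ r, L * |s - t| * η r := by
      refine norm_integral_le_of_norm_le (hint.const_mul _) (Eventually.of_forall fun r => ?_)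
      rw [← sub_mul, norm_mul, Real.norm_eq_abs, Real.norm_eq_abs, abs_of_nonneg (hη0 r)]
      refine mul_le_mul_of_nonneg_right ?_ (hη0 r)
      have := h.abs_sub_le (s - r) (t - r)
      rwa [sub_sub_sub_cancel_right] at this
    rwa [integral_const_mul, hη1, mul_one] at h2
  -- The regularised jump differentiates to a regularised delta at 1: ∫_1^∞ η'(t - s) ds = η(t - 1).
  have h2 : deriv (conv β η) t = deriv (conv g η) t + j * η (t - 1) := by
    rw [(hasDerivAt_conv h.measurable h.abs_le_add hη hc t).deriv,
      (hasDerivAt_conv h.continuous.measurable h.abs_le hη hc t).deriv]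
    have hind : ∀ s, (Ioi (1 : ℝ)).indicator (fun _ => (1 : ℝ)) s * deriv η (t - s) =
        (Ioi (1 : ℝ)).indicator (fun s => deriv η (t - s)) s := by
      intro s
      by_cases hs : s ∈ Ioi (1 : ℝ) <;> simp [hs]
    have h3 : ∫ s in Ioi (1 : ℝ), deriv η (t - s) = η (t - 1) := by
      have hd : ∀ s ∈ Ioi (1 : ℝ), HasDerivAt (fun s => -η (t - s)) (deriv η (t - s)) s := by
        intro s _
        have h4 : HasDerivAt η (deriv η (t - s)) (t - s) :=
          (hη.differentiable (by simp) _).hasDerivAt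
        have h5 := (h4.comp s ((hasDerivAt_id s).const_sub t)).neg
        refine h5.congr_deriv ?_
        ring
      have hlim : Tendsto (fun s => -η (t - s)) atTop (𝓝 0) := by
        have h6 : Tendsto η atBot (𝓝 0) :=
          (hc.is_zero_at_infty).mono_left atBot_le_cocompact
        have := (h6.comp (tendsto_atBot_add_const_left _ t tendsto_neg_atTop_atBot)).neg
        simpa [Function.comp_def, sub_eq_add_neg] using this
      have hcont : Continuous (fun s => -η (t - s)) := by
        have := hη.continuous
        fun_prop
      rw [integral_Ioi_of_hasDerivAt_of_tendsto
        hcont.continuousWithinAt hd (hint'.comp_sub_left t).integrableOn hlim]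
      ring
    have h4 : Integrable (fun s => (Ioi (1 : ℝ)).indicator (fun _ => (1 : ℝ)) s *
        deriv η (t - s)) := by
      simp only [hind]
      exact (hint'.comp_sub_left t).indicator measurableSet_Ioi
    have h5 : ∫ s, (Ioi (1 : ℝ)).indicator (fun _ => (1 : ℝ)) s * deriv η (t - s) = η (t - 1) := by
      simp only [hind]
      rw [integral_indicator measurableSet_Ioi, h3]
    rw [← h5, conv, conv, ← integral_const_mul, ← integral_add
      (integrable_conv_integrand h.continuous.measurable h.abs_le hint' t) (h4.const_mul j)]
    refine integral_congr_ae (Eventually.of_forall fun s => ?_)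
    beta_reduce
    rw [h.eq s]
    ring
  rw [h2]
  refine (abs_add_le _ _).trans (add_le_add h1 ?_)
  rw [abs_mul, abs_of_nonneg (hη0 _)]

end Regularisation

/-! ### The coefficient b_ε'/b_ε. -/

noncomputable section Coefficient

open Filter Topology

/-- Bounds for the derivatives of a logarithmic derivative `B' / B`. -/
theorem exists_logDeriv_bound {b₀ : ℝ} (hb₀ : 0 < b₀) (Q : ℕ → ℝ) (hQ : ∀ i, 0 ≤ Q i) (k : ℕ) :
    ∃ C : ℝ, 0 ≤ C ∧ ∀ (e : ℝ) (B : ℝ → ℝ), 1 ≤ e → ContDiff ℝ ∞ B → (∀ t, b₀ ≤ B t) →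
      (∀ i t, |iteratedDeriv i B t| ≤ Q i * e ^ i) → ∀ i ≤ k, ∀ t,
        |iteratedDeriv i (fun t => deriv B t / B t) t| ≤ C * e ^ (i + 1) := by
  have step : ∀ k : ℕ, ∀ C : ℝ, 0 ≤ C → ∀ (e : ℝ) (B : ℝ → ℝ), 1 ≤ e → ContDiff ℝ ∞ B →
      (∀ t, b₀ ≤ B t) → (∀ i t, |iteratedDeriv i B t| ≤ Q i * e ^ i) → ∀ t,
      (∀ i < k, |iteratedDeriv i (fun t => deriv B t / B t) t| ≤ C * e ^ (i + 1)) →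
        |iteratedDeriv k (fun t => deriv B t / B t) t| ≤
          b₀⁻¹ * (Q (k + 1) + ∑ i ∈ Finset.range k, (k.choose i : ℝ) * C * Q (k - i)) *
            e ^ (k + 1) := by
    intro k C hC e B he hB hlow hQB t hlt
    have hB0 : ∀ t, B t ≠ 0 := fun t => (hb₀.trans_le (hlow t)).ne'
    have hB' : ContDiff ℝ ∞ (deriv B) := (contDiff_infty_iff_deriv.mp hB).2
    set d : ℝ → ℝ := fun t => deriv B t / B t with hd
    have hds : ContDiff ℝ ∞ d := hB'.div hB hB0
    -- Leibniz' rule for this product can be solved for the top term `iteratedDeriv k d t * B t`;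
    -- dividing by B ≥ b₀ bounds it through lower derivatives of d, with no quotient rule of higher
    -- order.
    have hprod : d * B = deriv B := by
      ext t; simp only [hd, Pi.mul_apply]; exact div_mul_cancel₀ _ (hB0 t)
    have hle : ((k : ℕ) : WithTop ℕ∞) ≤ ∞ := by exact_mod_cast le_top
    have h1 := iteratedDeriv_mul (n := k) (x := t) (hds.contDiffAt.of_le hle)
      (hB.contDiffAt.of_le hle)
    rw [hprod, ← iteratedDeriv_succ', Finset.sum_range_succ] at h1
    simp only [Nat.choose_self, Nat.cast_one, one_mul, Nat.sub_self, iteratedDeriv_zero] at h1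
    have h2 : iteratedDeriv k d t * B t = iteratedDeriv (k + 1) B t -
        ∑ i ∈ Finset.range k, (k.choose i : ℝ) * iteratedDeriv i d t *
          iteratedDeriv (k - i) B t := by linarith
    have he0 : 0 ≤ e := by linarith
    have h3 : ∀ i ∈ Finset.range k, |(k.choose i : ℝ) * iteratedDeriv i d t *
        iteratedDeriv (k - i) B t| ≤ (k.choose i : ℝ) * C * Q (k - i) * e ^ (k + 1) := by
      intro i hi
      have hi' := Finset.mem_range.mp hi
      rw [abs_mul, abs_mul, Nat.abs_cast]
      calc _ ≤ (k.choose i : ℝ) * (C * e ^ (i + 1)) * (Q (k - i) * e ^ (k - i)) := by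
            refine mul_le_mul ?_ (hQB _ t) (abs_nonneg _) (by positivity)
            exact mul_le_mul_of_nonneg_left (hlt i hi') (Nat.cast_nonneg _)
        _ = _ := by
            have : e ^ (k + 1) = e ^ (i + 1) * e ^ (k - i) := by
              rw [← pow_add]; congr 1; omega
            rw [this]; ring
    have h4 : |iteratedDeriv k d t| * b₀ ≤
        (Q (k + 1) + ∑ i ∈ Finset.range k, (k.choose i : ℝ) * C * Q (k - i)) * e ^ (k + 1) := by
      calc |iteratedDeriv k d t| * b₀ ≤ |iteratedDeriv k d t| * |B t| :=
            mul_le_mul_of_nonneg_left ((hlow t).trans (le_abs_self _)) (abs_nonneg _)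
        _ = |iteratedDeriv k d t * B t| := (abs_mul _ _).symm
        _ ≤ Q (k + 1) * e ^ (k + 1) +
            ∑ i ∈ Finset.range k, (k.choose i : ℝ) * C * Q (k - i) * e ^ (k + 1) := by
            rw [h2]
            refine (abs_sub _ _).trans (add_le_add (hQB _ t) ?_)
            exact (Finset.abs_sum_le_sum_abs _ _).trans (Finset.sum_le_sum h3)
        _ = _ := by rw [← Finset.sum_mul]; ring
    rw [mul_assoc, inv_mul_eq_div, le_div_iff₀ hb₀]
    exact h4
  induction k with
  | zero =>
    refine ⟨b₀⁻¹ * (Q 1 + 0), by have := hQ 1; positivity, ?_⟩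
    intro e B he hB hlow hQB i hi t
    obtain rfl : i = 0 := by omega
    simpa using step 0 0 le_rfl e B he hB hlow hQB t (by simp)
  | succ k ih =>
    obtain ⟨C, hC0, hC⟩ := ih
    set C' : ℝ := b₀⁻¹ * (Q (k + 1 + 1) +
      ∑ i ∈ Finset.range (k + 1), ((k + 1).choose i : ℝ) * C * Q (k + 1 - i)) with hC'
    have hC'0 : 0 ≤ C' := by
      refine mul_nonneg (by positivity) (add_nonneg (hQ _) (Finset.sum_nonneg fun i _ => ?_))
      have := hQ (k + 1 - i)
      positivity
    refine ⟨C + C', by positivity, ?_⟩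
    intro e B he hB hlow hQB i hi t
    have hpow : 0 ≤ e ^ (i + 1) := by positivity
    rcases Nat.lt_or_ge i (k + 1) with h | h
    · refine (hC e B he hB hlow hQB i (by omega) t).trans ?_
      exact mul_le_mul_of_nonneg_right (by linarith) hpow
    · obtain rfl : i = k + 1 := by omega
      refine (step (k + 1) C hC0 e B he hB hlow hQB t
        fun i hi => hC e B he hB hlow hQB i (by omega) t).trans ?_
      rw [← hC']
      exact mul_le_mul_of_nonneg_right (by linarith) hpow

section Mollifier

variable {K ε : ℝ} {ψ : ℝ → ℝ}

theorem IsMollifier.hasCompactSupport (hψ : IsMollifier K ψ) : HasCompactSupport ψ := by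
  rw [HasCompactSupport, hψ.support]
  exact isCompact_Icc

theorem IsMollifier.contDiff_rescaled (hψ : IsMollifier K ψ) (ε : ℝ) :
    ContDiff ℝ ∞ (rescaled ψ ε) :=
  contDiff_const.mul (hψ.contDiff.comp (contDiff_const.mul contDiff_id))

theorem IsMollifier.hasCompactSupport_rescaled (hψ : IsMollifier K ψ) (hε : 0 < ε) :
    HasCompactSupport (rescaled ψ ε) :=
  (hψ.hasCompactSupport.comp_smul (inv_ne_zero hε.ne')).mul_left (f := fun _ => ε⁻¹)

theorem IsMollifier.rescaled_nonneg (hψ : IsMollifier K ψ) (hε : 0 < ε) (t : ℝ) :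
    0 ≤ rescaled ψ ε t :=
  mul_nonneg (inv_nonneg.mpr hε.le) (hψ.nonneg _)

theorem IsMollifier.integral_rescaled (hψ : IsMollifier K ψ) (hε : 0 < ε) :
    ∫ t, rescaled ψ ε t = 1 := by
  simp only [rescaled]
  rw [integral_const_mul, Measure.integral_comp_mul_left, hψ.integral, inv_inv, abs_of_pos hε,
    smul_eq_mul, mul_one, inv_mul_cancel₀ hε.ne']

theorem IsMollifier.integral_abs_iteratedDeriv_rescaled (hψ : IsMollifier K ψ) (hε : 0 < ε)
    (k : ℕ) : ∫ t, |iteratedDeriv k (rescaled ψ ε) t| =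
      (∫ t, |iteratedDeriv k ψ t|) * ε⁻¹ ^ k := by
  have hle : ((k : ℕ) : WithTop ℕ∞) ≤ ∞ := by exact_mod_cast le_top
  have hi : (0 : ℝ) < ε⁻¹ := inv_pos.mpr hε
  have h1 : ∀ t, |iteratedDeriv k (rescaled ψ ε) t| =
      ε⁻¹ * ε⁻¹ ^ k * |iteratedDeriv k ψ (ε⁻¹ * t)| := by
    intro t
    have h2 : ContDiff ℝ k (fun t => ψ (ε⁻¹ * t)) :=
      (hψ.contDiff.comp (contDiff_const.mul contDiff_id)).of_le hle
    change |iteratedDeriv k (fun t => ε⁻¹ * ψ (ε⁻¹ * t)) t| = _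
    rw [iteratedDeriv_const_mul _ h2.contDiffAt,
      iteratedDeriv_comp_const_mul (hψ.contDiff.of_le hle), abs_mul, abs_mul,
      abs_of_pos hi, abs_of_pos (pow_pos hi k), mul_assoc]
  simp only [h1]
  rw [integral_const_mul, Measure.integral_comp_mul_left (fun t => |iteratedDeriv k ψ t|), inv_inv,
    abs_of_pos hε, smul_eq_mul]
  field_simp

/-- Convolution ignores null sets, so b may be replaced by its jump form, whatever its value at 1.
-/
theorem regularised_eq_conv {b β : ℝ → ℝ} (h : b =ᵐ[volume] β) (ψ : ℝ → ℝ) (ε : ℝ) :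
    regularised b ψ ε = conv β (rescaled ψ ε) := by
  ext t
  refine integral_congr_ae ?_
  filter_upwards [h] with s hs
  rw [hs]

/-- The damping coefficients `b_ε' / b_ε` are controlled uniformly in `ε`. -/
theorem exists_dampingBound {b : ℝ → ℝ} {b₀ : ℝ} (hb₀ : 0 < b₀) (hb_lower : ∀ t, b₀ ≤ b t)
    (hb : IsPiecewiseCbInfty b) (hψ : IsMollifier K ψ) :
    ∃ (A : ℝ) (D : ℕ → ℝ), (∀ i, 0 ≤ D i) ∧
      ∀ ε ∈ Ioc (0 : ℝ) 1, DampingBound A D ε⁻¹ (dissipation b ψ ε) := by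
  obtain ⟨L, M, j, g, β, h, hbβ⟩ := hb.exists_hasJumpForm
  have hM0 : 0 ≤ M + |j| := (abs_nonneg _).trans (h.abs_le_add 0)
  -- The supremum of |β| times the L¹ norm of ψ^{(k)}; rescaling the mollifier contributes the
  -- remaining factor ε^{-k}.
  set Q : ℕ → ℝ := fun k => (M + |j|) * ∫ t, |iteratedDeriv k ψ t| with hQ
  have hQ0 : ∀ k, 0 ≤ Q k := fun k => mul_nonneg hM0 (integral_nonneg fun t => abs_nonneg _)
  choose D hD0 hD using exists_logDeriv_bound hb₀ Q hQ0
  have hβ0 : ∀ᵐ t, b₀ ≤ β t := by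
    filter_upwards [hbβ] with t ht
    rw [← ht]; exact hb_lower t
  have hint : ∀ ε ∈ Ioc (0 : ℝ) 1, ∀ k, Integrable (iteratedDeriv k (rescaled ψ ε)) :=
    fun ε hε k => (contDiff_iteratedDeriv (hψ.contDiff_rescaled ε) k).continuous
      |>.integrable_of_hasCompactSupport
        (hasCompactSupport_iteratedDeriv (hψ.hasCompactSupport_rescaled hε.1) k)
  have hlow : ∀ ε ∈ Ioc (0 : ℝ) 1, ∀ t, b₀ ≤ regularised b ψ ε t := by
    intro ε hε t
    rw [regularised_eq_conv hbβ]
    exact le_conv h.measurable h.abs_le_add hβ0 (by simpa using hint ε hε 0)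
      (hψ.rescaled_nonneg hε.1) (hψ.integral_rescaled hε.1) t
  have hsm : ∀ ε ∈ Ioc (0 : ℝ) 1, ContDiff ℝ ∞ (regularised b ψ ε) := by
    intro ε hε
    rw [regularised_eq_conv hbβ]
    exact contDiff_conv h.measurable h.abs_le_add (hψ.contDiff_rescaled ε)
      (hψ.hasCompactSupport_rescaled hε.1)
  have hQB : ∀ ε ∈ Ioc (0 : ℝ) 1, ∀ i t,
      |iteratedDeriv i (regularised b ψ ε) t| ≤ Q i * ε⁻¹ ^ i := by
    intro ε hε i t
    rw [regularised_eq_conv hbβ, iteratedDeriv_conv h.measurable h.abs_le_add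
      (hψ.contDiff_rescaled ε) (hψ.hasCompactSupport_rescaled hε.1)]
    refine (abs_conv_le h.abs_le_add (hint ε hε i) t).trans_eq ?_
    rw [hψ.integral_abs_iteratedDeriv_rescaled hε.1]
    simp only [hQ]
    ring
  have hder : ∀ ε ∈ Ioc (0 : ℝ) 1, ∀ i t,
      |iteratedDeriv i (dissipation b ψ ε) t| ≤ D i * ε⁻¹ ^ (i + 1) := fun ε hε i t =>
    hD i ε⁻¹ _ ((one_le_inv₀ hε.1).mpr hε.2) (hsm ε hε) (hlow ε hε) (hQB ε hε) i le_rfl t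
  -- Integrated over [0,2], the Lipschitz part contributes 2L and the concentrating kernel at most
  -- its unit mass times |j|; this constant is free of ε.
  refine ⟨b₀⁻¹ * (2 * L + |j|), D, hD0, fun ε hε => ⟨?_, fun i t _ => hder ε hε i t, ?_⟩⟩
  · exact (contDiff_infty_iff_deriv.mp (hsm ε hε)).2.div (hsm ε hε)
      fun t => (hb₀.trans_le (hlow ε hε t)).ne'
  · have hηc : Continuous (rescaled ψ ε) := (hψ.contDiff_rescaled ε).continuous
    have hηi : Integrable (rescaled ψ ε) := by simpa using hint ε hε 0
    refine ⟨fun t => b₀⁻¹ * (L + |j| * rescaled ψ ε (t - 1)), by fun_prop, fun t _ => ?_, ?_⟩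
    · have h1 := h.abs_deriv_conv_le (hψ.contDiff_rescaled ε)
        (hψ.hasCompactSupport_rescaled hε.1) (hψ.rescaled_nonneg hε.1)
        (hψ.integral_rescaled hε.1) t
      rw [← regularised_eq_conv hbβ] at h1
      have h2 : b₀ ≤ |regularised b ψ ε t| := (hlow ε hε t).trans (le_abs_self _)
      beta_reduce
      rw [dissipation, abs_div, inv_mul_eq_div]
      exact div_le_div₀ ((abs_nonneg _).trans h1) h1 hb₀ h2
    · have h1 : ∫ t in (0 : ℝ)..2, rescaled ψ ε (t - 1) ≤ 1 := by
        rw [intervalIntegral.integral_of_le zero_le_two]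
        refine (setIntegral_le_integral (hηi.comp_sub_right 1)
          (Eventually.of_forall fun t => hψ.rescaled_nonneg hε.1 _)).trans_eq ?_
        rw [integral_sub_right_eq_self (rescaled ψ ε), hψ.integral_rescaled hε.1]
      have hi : IntervalIntegrable (fun t => rescaled ψ ε (t - 1)) volume 0 2 :=
        (hηc.comp (continuous_id.sub continuous_const)).intervalIntegrable _ _
      rw [intervalIntegral.integral_const_mul, intervalIntegral.integral_add
        intervalIntegrable_const (hi.const_mul _), intervalIntegral.integral_const_mul,
        intervalIntegral.integral_const]
      have h2 := mul_le_mul_of_nonneg_left h1 (abs_nonneg j)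
      refine mul_le_mul_of_nonneg_left ?_ (by positivity)
      rw [smul_eq_mul]
      linarith

end Mollifier

end Coefficient

/-! ### Construction of a solution by Fourier multipliers. -/

noncomputable section WaveFamily

open Filter Topology FourierTransform

theorem bracket_one_sq {n : ℕ} (ξ : Rn n) : bracket 1 ξ ^ 2 = 1 + ‖ξ‖ ^ 2 := by
  have h := bracket_natCast 2 ξ
  rw [← h]
  exact_mod_cast bracket_two ξ

theorem bracket_one_sq_le {n : ℕ} (ξ : Rn n) : bracket 1 ξ ^ 2 ≤ laplaceSymbol ξ + 1 := by
  rw [bracket_one_sq, laplaceSymbol]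
  nlinarith [Real.pi_gt_three, sq_nonneg ‖ξ‖,
    mul_nonneg (by nlinarith [Real.pi_gt_three] : 0 ≤ (2 * Real.pi) ^ 2 - 1) (sq_nonneg ‖ξ‖)]

theorem laplaceSymbol_add_one_le {n : ℕ} (ξ : Rn n) :
    laplaceSymbol ξ + 1 ≤ (2 * Real.pi) ^ 2 * bracket 1 ξ ^ 2 := by
  rw [bracket_one_sq, laplaceSymbol]
  nlinarith [Real.pi_gt_three]

/-- The fundamental solutions `P`, `Q` of the damped oscillators, with the bounds that make them
Fourier multipliers from the data to `∂_t^m u ∈ H^s`, `s + m ≤ 1`. -/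
structure IsWaveFamily (n : ℕ) (d : ℝ → ℝ) (e : ℝ) (C : ℕ → ℝ) (P Q : ℝ → ℕ → ℝ → ℝ) : Prop where
  left : IsOscillator d 1 0 P
  right : IsOscillator d 0 1 Q
  left_le : ∀ (m : ℕ) (s : ℝ), s + m ≤ 1 → ∀ t ∈ Icc (0 : ℝ) 2, ∀ ξ : Rn n,
    |bracket (s - 1) ξ * P (laplaceSymbol ξ) m t| ≤ C m * e ^ (m - 1)
  right_le : ∀ (m : ℕ) (s : ℝ), s + m ≤ 1 → ∀ t ∈ Icc (0 : ℝ) 2, ∀ ξ : Rn n,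
    |bracket s ξ * Q (laplaceSymbol ξ) m t| ≤ C m * e ^ (m - 1)

/-- The oscillator bounds are used with w = ⟨ξ⟩ and κ = (2π)². The weight for P is ⟨ξ⟩^{s-1} because
the coordinate of u₀ ∈ H¹ already contains one factor ⟨ξ⟩; for Q this factor is supplied by the gain
of one order from the data (0, 1). Both reduce to ⟨ξ⟩^{s-1+m} ≤ 1. -/
theorem exists_isWaveFamily (n : ℕ) (A : ℝ) (D : ℕ → ℝ) (hD : ∀ i, 0 ≤ D i) :
    ∃ C : ℕ → ℝ, (∀ m, 0 ≤ C m) ∧ ∀ (e : ℝ) (d : ℝ → ℝ), 1 ≤ e → DampingBound A D e d →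
      ∃ P Q, IsWaveFamily n d e C P Q := by
  choose C hC0 hC using exists_oscillator_bound A ((2 * Real.pi) ^ 2) D hD (by positivity)
  refine ⟨C, hC0, fun e d he hd => ?_⟩
  obtain ⟨P, hP⟩ := exists_isOscillator hd.contDiff 1 0
  obtain ⟨Q, hQ⟩ := exists_isOscillator hd.contDiff 0 1
  have hdec : ∀ (m : ℕ) (s : ℝ) (ξ : Rn n), s + m ≤ 1 →
      bracket (s - 1) ξ * (C m * e ^ (m - 1) * bracket 1 ξ ^ m) ≤ C m * e ^ (m - 1) := by
    intro m s ξ hs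
    have h1 : bracket (s - 1) ξ * bracket 1 ξ ^ m ≤ 1 := by
      rw [← bracket_natCast, bracket_mul]
      exact bracket_le_one (by linarith) ξ
    have h2 : 0 ≤ C m * e ^ (m - 1) := mul_nonneg (hC0 m) (by positivity)
    nlinarith [mul_le_mul_of_nonneg_left h1 h2]
  refine ⟨P, Q, hP, hQ, fun m s hs t ht ξ => ?_, fun m s hs t ht ξ => ?_⟩
  · have h := hC m e _ _ 1 0 d P he hd hP (laplaceSymbol_nonneg ξ)
      (one_le_bracket zero_le_one ξ) (bracket_one_sq_le ξ) (laplaceSymbol_add_one_le ξ) t ht m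
      le_rfl
    rw [abs_one, abs_zero, mul_one, add_zero, mul_comm (bracket 1 ξ)] at h
    have h' := le_of_mul_le_mul_right h (bracket_pos 1 ξ)
    rw [abs_mul, abs_of_pos (bracket_pos _ ξ)]
    exact (mul_le_mul_of_nonneg_left h' (bracket_pos _ ξ).le).trans (hdec m s ξ hs)
  · have h := hC m e _ _ 0 1 d Q he hd hQ (laplaceSymbol_nonneg ξ)
      (one_le_bracket zero_le_one ξ) (bracket_one_sq_le ξ) (laplaceSymbol_add_one_le ξ) t ht m
      le_rfl
    rw [abs_one, abs_zero, mul_zero, zero_add, mul_one] at h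
    have h1 : bracket s ξ = bracket (s - 1) ξ * bracket 1 ξ := by
      rw [bracket_mul, sub_add_cancel]
    rw [abs_mul, abs_of_pos (bracket_pos _ ξ), h1, mul_assoc]
    exact (mul_le_mul_of_nonneg_left h (bracket_pos _ ξ).le).trans (hdec m s ξ hs)

/-- The function `∂_t^m u(t) ∈ H^s` for the solution `u` with data `u₀`, `u₁`. -/
def waveJet {n : ℕ} (P Q : ℝ → ℕ → ℝ → ℝ) (u₀ : Sobolev n 1) (u₁ : L2 n) (s : ℝ) (m : ℕ) (t : ℝ) :
    Sobolev n s :=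
  (Sobolev.ft n s).symm (mulL (fun ξ => bracket (s - 1) ξ * P (laplaceSymbol ξ) m t)
      (Sobolev.ft n 1 u₀) + mulL (fun ξ => bracket s ξ * Q (laplaceSymbol ξ) m t) (𝓕 u₁))

theorem mulL_add_add_smul_eq_zero {n : ℕ} {m₁ m₂ m₃ : Rn n → ℝ} (h₁ : IsBddMeas m₁)
    (h₂ : IsBddMeas m₂) (h₃ : IsBddMeas m₃) {c : ℝ}
    (h : ∀ ξ, m₁ ξ + m₂ ξ + c * m₃ ξ = 0) (f : L2 n) :
    mulL m₁ f + mulL m₂ f + (c : ℂ) • mulL m₃ f = 0 := by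
  apply Lp.ext
  filter_upwards [mulL_ae h₁ f, mulL_ae h₂ f, mulL_ae h₃ f, Lp.coeFn_zero ℂ 2 volume,
    Lp.coeFn_add (mulL m₁ f + mulL m₂ f) ((c : ℂ) • mulL m₃ f),
    Lp.coeFn_add (mulL m₁ f) (mulL m₂ f), Lp.coeFn_smul (c : ℂ) (mulL m₃ f)]
    with ξ e1 e2 e3 e4 e5 e6 e7
  rw [e5, Pi.add_apply, e6, Pi.add_apply, e7, Pi.smul_apply, e1, e2, e3, e4, smul_eq_mul]
  have h' : (m₁ ξ : ℂ) + m₂ ξ + c * m₃ ξ = 0 := by exact_mod_cast h ξ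
  rw [Pi.zero_apply]
  linear_combination f ξ * h'

theorem IsOscillator.recursion_zero {d : ℝ → ℝ} {p q : ℝ} {J : ℝ → ℕ → ℝ → ℝ}
    (h : IsOscillator d p q J) (l : ℝ) {t : ℝ} (ht : t ∈ Icc (0 : ℝ) 2) :
    J l 2 t = -l * J l 0 t - d t * J l 1 t := by
  simpa using h.recursion l 0 t ht

theorem mulL_zero {n : ℕ} (f : L2 n) : mulL (fun _ => 0) f = 0 := by
  apply norm_le_zero_iff.mp
  simpa using norm_mulL_le (m := fun _ : Rn n => (0 : ℝ)) (C := 0)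
    ⟨measurable_const, 0, by simp⟩ (by simp) f

namespace IsWaveFamily

variable {n : ℕ} {d : ℝ → ℝ} {e : ℝ} {C : ℕ → ℝ} {P Q : ℝ → ℕ → ℝ → ℝ} {s t : ℝ} {m : ℕ}

theorem ft_waveJet (u₀ : Sobolev n 1) (u₁ : L2 n) :
    Sobolev.ft n s (waveJet P Q u₀ u₁ s m t) =
      mulL (fun ξ => bracket (s - 1) ξ * P (laplaceSymbol ξ) m t) (Sobolev.ft n 1 u₀) +
        mulL (fun ξ => bracket s ξ * Q (laplaceSymbol ξ) m t) (𝓕 u₁) :=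
  (Sobolev.ft n s).apply_symm_apply _

theorem measurable_left (h : IsWaveFamily n d e C P Q) (σ : ℝ) (m : ℕ) (ht : t ∈ Icc (0 : ℝ) 2) :
    Measurable (fun ξ : Rn n => bracket σ ξ * P (laplaceSymbol ξ) m t) :=
  (measurable_bracket σ).mul ((h.left.continuous m t ht).measurable.comp measurable_laplaceSymbol)

theorem measurable_right (h : IsWaveFamily n d e C P Q) (σ : ℝ) (m : ℕ)
    (ht : t ∈ Icc (0 : ℝ) 2) :
    Measurable (fun ξ : Rn n => bracket σ ξ * Q (laplaceSymbol ξ) m t) :=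
  (measurable_bracket σ).mul ((h.right.continuous m t ht).measurable.comp measurable_laplaceSymbol)

theorem isBddMeas_left (h : IsWaveFamily n d e C P Q) (hs : s + m ≤ 1) (ht : t ∈ Icc (0 : ℝ) 2) :
    IsBddMeas (fun ξ : Rn n => bracket (s - 1) ξ * P (laplaceSymbol ξ) m t) :=
  ⟨h.measurable_left _ _ ht, _, h.left_le m s hs t ht⟩

theorem isBddMeas_right (h : IsWaveFamily n d e C P Q) (hs : s + m ≤ 1)
    (ht : t ∈ Icc (0 : ℝ) 2) :
    IsBddMeas (fun ξ : Rn n => bracket s ξ * Q (laplaceSymbol ξ) m t) :=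
  ⟨h.measurable_right _ _ ht, _, h.right_le m s hs t ht⟩

/-- The difference quotient is taken in a fixed H^s, so s must leave room for order m + 1, whose
symbol bounds the quotients. -/
theorem hasDerivWithinAt_waveJet (h : IsWaveFamily n d e C P Q) (u₀ : Sobolev n 1) (u₁ : L2 n)
    (hs : s + (m + 1 : ℕ) ≤ 1) (ht : t ∈ Icc (0 : ℝ) 2) :
    HasDerivWithinAt (waveJet P Q u₀ u₁ s m) (waveJet P Q u₀ u₁ s (m + 1) t) (Icc 0 2) t := by
  have hs' : s + m ≤ 1 := by push_cast at hs; linarith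
  have h1 := hasDerivWithinAt_mulL (convex_Icc (0 : ℝ) 2)
    (m := fun t ξ => bracket (s - 1) ξ * P (laplaceSymbol ξ) m t)
    (fun t ht => h.measurable_left _ _ ht) (fun t ht => h.measurable_left _ _ ht)
    (h.left_le m s hs') (h.left_le (m + 1) s hs)
    (fun ξ t ht => (h.left.hasDerivWithinAt _ m t ht).const_mul _) (Sobolev.ft n 1 u₀) ht
  have h2 := hasDerivWithinAt_mulL (convex_Icc (0 : ℝ) 2)
    (m := fun t ξ => bracket s ξ * Q (laplaceSymbol ξ) m t)
    (fun t ht => h.measurable_right _ _ ht) (fun t ht => h.measurable_right _ _ ht)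
    (h.right_le m s hs') (h.right_le (m + 1) s hs)
    (fun ξ t ht => (h.right.hasDerivWithinAt _ m t ht).const_mul _) (𝓕 u₁) ht
  exact (((Sobolev.ft n s).symm.toContinuousLinearEquiv :
    L2 n →L[ℂ] Sobolev n s).restrictScalars ℝ).hasFDerivAt.comp_hasDerivWithinAt t (h1.add h2)

/-- In the borderline case s + m = 1 the next derivative need not lie in H^s, so continuity is
obtained directly by dominated convergence. -/
theorem continuousOn_waveJet (h : IsWaveFamily n d e C P Q) (u₀ : Sobolev n 1) (u₁ : L2 n)
    (hs : s + m ≤ 1) : ContinuousOn (waveJet P Q u₀ u₁ s m) (Icc 0 2) := by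
  intro t ht
  refine (Sobolev.ft n s).symm.continuous.continuousAt.comp_continuousWithinAt
    (ContinuousWithinAt.add ?_ ?_)
  · refine tendsto_mulL (C := C m * e ^ (m - 1)) ?_ (h.isBddMeas_left hs ht) ?_ ?_ _
    · filter_upwards [self_mem_nhdsWithin] with r hr using h.measurable_left _ _ hr
    · filter_upwards [self_mem_nhdsWithin] with r hr using h.left_le m s hs r hr
    · exact fun ξ => ((h.left.hasDerivWithinAt _ m t ht).const_mul _).continuousWithinAt
  · refine tendsto_mulL (C := C m * e ^ (m - 1)) ?_ (h.isBddMeas_right hs ht) ?_ ?_ _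
    · filter_upwards [self_mem_nhdsWithin] with r hr using h.measurable_right _ _ hr
    · filter_upwards [self_mem_nhdsWithin] with r hr using h.right_le m s hs r hr
    · exact fun ξ => ((h.right.hasDerivWithinAt _ m t ht).const_mul _).continuousWithinAt

theorem norm_waveJet_le (h : IsWaveFamily n d e C P Q) (u₀ : Sobolev n 1) (u₁ : L2 n)
    (hs : s + m ≤ 1) (ht : t ∈ Icc (0 : ℝ) 2) :
    ‖waveJet P Q u₀ u₁ s m t‖ ≤ C m * e ^ (m - 1) * (‖u₀‖ + ‖u₁‖) := by
  rw [← (Sobolev.ft n s).norm_map, ft_waveJet, mul_add]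
  refine (norm_add_le _ _).trans (add_le_add ?_ ?_)
  · refine (norm_mulL_le (h.isBddMeas_left hs ht) (h.left_le m s hs t ht) _).trans_eq ?_
    rw [(Sobolev.ft n 1).norm_map]
  · refine (norm_mulL_le (h.isBddMeas_right hs ht) (h.right_le m s hs t ht) _).trans_eq ?_
    rw [Lp.norm_fourier_eq]

theorem curveIn_waveJet (h : IsWaveFamily n d e C P Q) (u₀ : Sobolev n 1) (u₁ : L2 n)
    (hs : s ≤ 1) (ht : t ∈ Icc (0 : ℝ) 2) :
    curveIn hs (waveJet P Q u₀ u₁ 1 0) t = waveJet P Q u₀ u₁ s 0 t := by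
  apply (Sobolev.ft n s).injective
  have h1 : (1 : ℝ) + (0 : ℕ) ≤ 1 := by simp
  rw [curveIn, Sobolev.ft_incl, ft_waveJet, ft_waveJet, map_add,
    mulL_mulL (isBddMeas_bracket (by linarith)) (h.isBddMeas_left h1 ht),
    mulL_mulL (isBddMeas_bracket (by linarith)) (h.isBddMeas_right h1 ht)]
  congr 3
  · ext ξ
    rw [sub_self, bracket_zero, one_mul]
  · ext ξ
    rw [← mul_assoc, bracket_mul, sub_add_cancel]

theorem contDiffOn_curveIn (h : IsWaveFamily n d e C P Q) (u₀ : Sobolev n 1) (u₁ : L2 n)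
    (hs : s ≤ 1) {N : ℕ} (hN : s + N ≤ 1) :
    ContDiffOn ℝ N (curveIn hs (waveJet P Q u₀ u₁ 1 0)) (Icc 0 2) ∧ ∀ m ≤ N, ∀ t ∈ Icc (0 : ℝ) 2,
      timeDeriv hs m (waveJet P Q u₀ u₁ 1 0) t = waveJet P Q u₀ u₁ s m t := by
  have hm : ∀ m ≤ N, s + m ≤ 1 := fun m hm => by
    have : (m : ℝ) ≤ N := by exact_mod_cast hm
    linarith
  obtain ⟨h1, h2⟩ := contDiffOn_of_chain (uniqueDiffOn_Icc (by norm_num : (0 : ℝ) < 2)) (N := N)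
    (f := waveJet P Q u₀ u₁ s) (h.continuousOn_waveJet u₀ u₁ hN)
    (fun m hmN t ht => h.hasDerivWithinAt_waveJet u₀ u₁ (hm _ hmN) ht)
  have heq : EqOn (curveIn hs (waveJet P Q u₀ u₁ 1 0)) (waveJet P Q u₀ u₁ s 0) (Icc 0 2) :=
    fun t ht => h.curveIn_waveJet u₀ u₁ hs ht
  refine ⟨h1.congr heq, fun m hmN t ht => ?_⟩
  rw [timeDeriv, iteratedDerivWithin_congr heq ht, h2 m hmN ht]

theorem isEnergySolution (h : IsWaveFamily n d e C P Q) (u₀ : Sobolev n 1) (u₁ : L2 n) :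
    IsEnergySolution d u₀ u₁ (waveJet P Q u₀ u₁ 1 0) := by
  have h0 : (0 : ℝ) ∈ Icc (0 : ℝ) 2 := by simp
  have hone := h.contDiffOn_curveIn u₀ u₁ (s := 0) zero_le_one (N := 1) (by norm_num)
  have htwo := h.contDiffOn_curveIn u₀ u₁ (s := -1) (by norm_num) (N := 2) (by norm_num)
  refine ⟨h.continuousOn_waveJet u₀ u₁ (by simp), by exact_mod_cast hone.1,
    by exact_mod_cast htwo.1, ?_, ?_, ?_⟩
  · apply (Sobolev.ft n 1).injective
    rw [ft_waveJet]
    simp only [h.left.initial, h.right.initial, sub_self, bracket_zero, mul_one, mul_zero]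
    rw [mulL_one, mulL_zero, add_zero]
  · apply Sobolev.toDist_eq_of_ft_zero
    rw [hone.2 1 le_rfl 0 h0, ft_waveJet]
    simp only [h.left.initial_deriv, h.right.initial_deriv, bracket_zero, mul_one, mul_zero]
    rw [mulL_one, mulL_zero, zero_add]
  · intro t ht
    rw [hone.2 1 le_rfl t ht, htwo.2 2 le_rfl t ht, Sobolev.equation_iff, ft_waveJet, ft_waveJet,
      ft_waveJet, map_add, map_add]
    have b1 := h.isBddMeas_left (s := -1) (m := 2) (by norm_num) ht
    have b2 := h.isBddMeas_right (s := -1) (m := 2) (by norm_num) ht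
    have b3 := h.isBddMeas_left (s := 1) (m := 0) (by norm_num) ht
    have b4 := h.isBddMeas_right (s := 1) (m := 0) (by norm_num) ht
    have b5 := h.isBddMeas_left (s := 0) (m := 1) (by norm_num) ht
    have b6 := h.isBddMeas_right (s := 0) (m := 1) (by norm_num) ht
    have hb : IsBddMeas (bracket (-1) : Rn n → ℝ) := isBddMeas_bracket (by norm_num)
    have hl := isBddMeas_laplaceSymbol_mul_bracket (n := n)
    rw [mulL_mulL hl b3, mulL_mulL hl b4, mulL_mulL hb b5, mulL_mulL hb b6]
    -- The three symbols share the factor ⟨ξ⟩⁻², and what remains is the oscillator equation at l =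
    -- |2πξ|². For Q below the common factor is ⟨ξ⟩⁻¹.
    have eP : mulL (fun ξ : Rn n => bracket (-1 - 1) ξ * P (laplaceSymbol ξ) 2 t)
        (Sobolev.ft n 1 u₀) + mulL (fun ξ => laplaceSymbol ξ * bracket (-2) ξ *
        (bracket (1 - 1) ξ * P (laplaceSymbol ξ) 0 t)) (Sobolev.ft n 1 u₀) +
        (d t : ℂ) • mulL (fun ξ => bracket (-1) ξ * (bracket (0 - 1) ξ *
        P (laplaceSymbol ξ) 1 t)) (Sobolev.ft n 1 u₀) = 0 := by
      refine mulL_add_add_smul_eq_zero b1 (hl.mul b3) (hb.mul b5) (fun ξ => ?_) _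
      have hr := h.left.recursion_zero (laplaceSymbol ξ) ht
      have h1 : bracket (-1) ξ * bracket (0 - 1) ξ = bracket (-2) ξ := by
        rw [bracket_mul]; norm_num
      have h2 : bracket (-1 - 1) ξ = bracket (-2) ξ := by norm_num
      rw [← mul_assoc (bracket (-1) ξ), h1, h2, sub_self, bracket_zero, hr]
      ring
    have eQ : mulL (fun ξ : Rn n => bracket (-1) ξ * Q (laplaceSymbol ξ) 2 t)
        (𝓕 u₁) + mulL (fun ξ => laplaceSymbol ξ * bracket (-2) ξ *
        (bracket 1 ξ * Q (laplaceSymbol ξ) 0 t)) (𝓕 u₁) +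
        (d t : ℂ) • mulL (fun ξ => bracket (-1) ξ * (bracket 0 ξ *
        Q (laplaceSymbol ξ) 1 t)) (𝓕 u₁) = 0 := by
      refine mulL_add_add_smul_eq_zero b2 (hl.mul b4) (hb.mul b6) (fun ξ => ?_) _
      have hr := h.right.recursion_zero (laplaceSymbol ξ) ht
      have h1 : bracket (-1) ξ = bracket (-2) ξ * bracket 1 ξ := by
        rw [bracket_mul]; norm_num
      rw [h1, bracket_zero, hr]
      ring
    refine Eq.trans ?_ ((congrArg₂ (fun x y : L2 n => x + y) eP eQ).trans (add_zero 0))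
    rw [smul_add]
    abel

end IsWaveFamily

end WaveFamily

/-! ### Uniqueness of finite energy solutions. -/

noncomputable section Uniqueness

open Filter Topology FourierTransform

variable {n : ℕ} {d : ℝ → ℝ} {u₀ : Sobolev n 1} {u₁ : L2 n} {w : ℝ → Sobolev n 1} {t : ℝ}

theorem curveIn_neg_one (w : ℝ → Sobolev n 1) :
    curveIn (s := -1) (by norm_num) w =
      fun t => Sobolev.inclCLM (by norm_num : (-1 : ℝ) ≤ 0) (curveIn zero_le_one w t) := by
  ext t
  rw [Sobolev.inclCLM_apply]
  apply Sobolev.toDist_injective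
  rw [curveIn, curveIn, Sobolev.toDist_incl, Sobolev.toDist_incl, Sobolev.toDist_incl]

namespace IsEnergySolution

theorem hasDerivWithinAt_curveIn (h : IsEnergySolution d u₀ u₁ w) (ht : t ∈ Icc (0 : ℝ) 2) :
    HasDerivWithinAt (curveIn (s := -1) (by norm_num) w)
      (Sobolev.incl (by norm_num : (-1 : ℝ) ≤ 0) (timeDeriv (s := 0) zero_le_one 1 w t))
      (Icc 0 2) t := by
  have h1 : HasDerivWithinAt (curveIn (s := 0) zero_le_one w)
      (timeDeriv (s := 0) zero_le_one 1 w t) (Icc 0 2) t := by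
    rw [timeDeriv, iteratedDerivWithin_one]
    exact (h.contDiffOn_one.differentiableOn (by simp) t ht).hasDerivWithinAt
  rw [curveIn_neg_one, ← Sobolev.inclCLM_apply]
  exact ((Sobolev.inclCLM (by norm_num : (-1 : ℝ) ≤ 0)).restrictScalars ℝ).hasFDerivAt
    |>.comp_hasDerivWithinAt t h1

/-- The C¹ and C² conditions refer to different spaces. Continuity of H⁰ ⊆ H⁻¹ identifies the first
derivatives taken in the two, so u_t may be differentiated in H⁻¹. -/
theorem hasDerivWithinAt_incl_timeDeriv (h : IsEnergySolution d u₀ u₁ w)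
    (ht : t ∈ Icc (0 : ℝ) 2) :
    HasDerivWithinAt
      (fun t => Sobolev.incl (by norm_num : (-1 : ℝ) ≤ 0) (timeDeriv (s := 0) zero_le_one 1 w t))
      (timeDeriv (s := -1) (by norm_num) 2 w t) (Icc 0 2) t := by
  have hU : UniqueDiffOn ℝ (Icc (0 : ℝ) 2) := uniqueDiffOn_Icc (by norm_num)
  have heq : EqOn (fun t => Sobolev.incl (by norm_num : (-1 : ℝ) ≤ 0)
      (timeDeriv (s := 0) zero_le_one 1 w t))
      (iteratedDerivWithin 1 (curveIn (s := -1) (by norm_num) w) (Icc 0 2)) (Icc 0 2) := by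
    intro r hr
    rw [iteratedDerivWithin_one]
    exact ((h.hasDerivWithinAt_curveIn hr).derivWithin (hU r hr)).symm
  have h1 : HasDerivWithinAt (iteratedDerivWithin 1 (curveIn (s := -1) (by norm_num) w) (Icc 0 2))
      (timeDeriv (s := -1) (by norm_num) 2 w t) (Icc 0 2) t := by
    rw [timeDeriv, iteratedDerivWithin_succ (n := 1)]
    exact (h.contDiffOn_two.differentiableOn_iteratedDerivWithin (m := 1) (by norm_num) hU
      t ht).hasDerivWithinAt
  exact h1.congr_of_mem heq ht

/-- The solution with its frequencies cut off by `χ`, and its time derivative. -/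
def cutoff (χ : Rn n → ℝ) (w : ℝ → Sobolev n 1) (t : ℝ) : L2 n × L2 n :=
  (mulL χ (Sobolev.ft n 1 (w t)), mulL (fun ξ => χ ξ * bracket 1 ξ)
    (Sobolev.ft n 0 (timeDeriv (s := 0) zero_le_one 1 w t)))

/-- On bounded frequencies -Δ is a bounded operator, so the truncated pair solves a linear ODE in L²
× L². Idempotence of χ allows a second cutoff to be put on the Laplacian. -/
theorem hasDerivWithinAt_cutoff (h : IsEnergySolution d u₀ u₁ w) {χ : Rn n → ℝ}
    (hχ : IsBddMeas χ) (hχ2 : IsBddMeas (fun ξ => χ ξ * bracket 2 ξ))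
    (hχχ : ∀ ξ, χ ξ * χ ξ = χ ξ) (ht : t ∈ Icc (0 : ℝ) 2) :
    HasDerivWithinAt (cutoff χ w) ((cutoff χ w t).2,
      -(mulL (fun ξ => χ ξ * laplaceSymbol ξ) (cutoff χ w t).1) - d t • (cutoff χ w t).2)
      (Icc 0 2) t := by
  have hχ1 : IsBddMeas (fun ξ => χ ξ * bracket 1 ξ) := by
    have := hχ2.mul (isBddMeas_bracket (n := n) (s := -1) (by norm_num))
    convert this using 2 with ξ
    rw [mul_assoc, bracket_mul]; norm_num
  have hχl : IsBddMeas (fun ξ => χ ξ * laplaceSymbol ξ) := by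
    have := hχ2.mul (isBddMeas_laplaceSymbol_mul_bracket (n := n))
    convert this using 2 with ξ
    have h1 : bracket 2 ξ * bracket (-2) ξ = 1 := by rw [bracket_mul]; norm_num [bracket_zero]
    linear_combination (-(χ ξ * laplaceSymbol ξ)) * h1
  -- The weight χ⟨ξ⟩² undoes the loss incurred by passing to H⁻¹. One continuous map thus produces
  -- both components, and differentiability in H⁻¹ is enough.
  set T : Sobolev n (-1) →L[ℝ] L2 n := ((mulL (fun ξ => χ ξ * bracket 2 ξ)) ∘L
    ((Sobolev.ft n (-1)).toContinuousLinearEquiv : Sobolev n (-1) →L[ℂ] L2 n)).restrictScalars ℝ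
    with hT
  have hTa : ∀ f, T f = mulL (fun ξ => χ ξ * bracket 2 ξ) (Sobolev.ft n (-1) f) := fun f => rfl
  have hb2 : IsBddMeas (bracket (-1 - 1) : Rn n → ℝ) := isBddMeas_bracket (by norm_num)
  have hb1 : IsBddMeas (bracket (-1 - 0) : Rn n → ℝ) := isBddMeas_bracket (by norm_num)
  have e1 : ∀ t, (cutoff χ w t).1 = T (curveIn (s := -1) (by norm_num) w t) := by
    intro t
    rw [hTa, curveIn, Sobolev.ft_incl, mulL_mulL hχ2 hb2]
    simp only [cutoff]
    congr 2
    ext ξ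
    rw [mul_assoc, bracket_mul]; norm_num [bracket_zero]
  have e2 : ∀ t, (cutoff χ w t).2 = T (Sobolev.incl (by norm_num : (-1 : ℝ) ≤ 0)
      (timeDeriv (s := 0) zero_le_one 1 w t)) := by
    intro t
    rw [hTa, Sobolev.ft_incl, mulL_mulL hχ2 hb1]
    simp only [cutoff]
    congr 2
    ext ξ
    rw [mul_assoc, bracket_mul]; norm_num
  have e3 : T (timeDeriv (s := -1) (by norm_num) 2 w t) =
      -(mulL (fun ξ => χ ξ * laplaceSymbol ξ) (cutoff χ w t).1) - d t • (cutoff χ w t).2 := by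
    have heq := (Sobolev.equation_iff _ _ _ _).mp (h.equation t ht)
    have heq' : Sobolev.ft n (-1) (timeDeriv (s := -1) (by norm_num) 2 w t) =
        -(mulL (fun ξ => laplaceSymbol ξ * bracket (-2) ξ) (Sobolev.ft n 1 (w t))) -
          (d t : ℂ) • mulL (bracket (-1)) (Sobolev.ft n 0 (timeDeriv zero_le_one 1 w t)) := by
      rw [add_assoc] at heq
      rw [eq_neg_of_add_eq_zero_left heq]
      abel
    rw [hTa, heq', map_sub, map_neg, map_smul, mulL_mulL hχ2 isBddMeas_laplaceSymbol_mul_bracket,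
      mulL_mulL hχ2 (isBddMeas_bracket (by norm_num)), Complex.coe_smul]
    simp only [cutoff]
    rw [mulL_mulL hχl hχ]
    congr 4
    · ext ξ
      have h1 : bracket 2 ξ * bracket (-2) ξ = 1 := by rw [bracket_mul]; norm_num [bracket_zero]
      linear_combination χ ξ * laplaceSymbol ξ * h1 - laplaceSymbol ξ * hχχ ξ
    · ext ξ
      rw [mul_assoc, bracket_mul]; norm_num
  have h1 := T.hasFDerivAt.comp_hasDerivWithinAt t (h.hasDerivWithinAt_curveIn ht)
  have h2 := T.hasFDerivAt.comp_hasDerivWithinAt t (h.hasDerivWithinAt_incl_timeDeriv ht)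
  rw [← e3]
  have e4 : cutoff χ w = fun t => ((T ∘ curveIn (s := -1) (by norm_num) w) t,
      (T ∘ fun t => Sobolev.incl (by norm_num : (-1 : ℝ) ≤ 0)
        (timeDeriv (s := 0) zero_le_one 1 w t)) t) := by
    ext t : 1
    exact Prod.ext (e1 t) (e2 t)
  have e5 := e2 t
  rw [e5, e4]
  exact h1.prodMk h2

theorem cutoff_zero (h : IsEnergySolution d u₀ u₁ w) (χ : Rn n → ℝ) :
    cutoff χ w 0 = (mulL χ (Sobolev.ft n 1 u₀), mulL (fun ξ => χ ξ * bracket 1 ξ) (𝓕 u₁)) := by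
  rw [cutoff, h.initial, Sobolev.ft_zero_of_toDist_eq h.initial_deriv]

/-- For each ball of frequencies the truncations solve the same Lipschitz ODE with the same initial
value, hence agree; the balls of integer radius exhaust all frequencies. -/
theorem eqOn (hd : Continuous d) {v : ℝ → Sobolev n 1} (hw : IsEnergySolution d u₀ u₁ w)
    (hv : IsEnergySolution d u₀ u₁ v) : EqOn w v (Icc 0 2) := by
  intro t ht
  set χ : ℕ → Rn n → ℝ := fun R => (Metric.closedBall (0 : Rn n) R).indicator fun _ => 1 with hχdef
  have hχm : ∀ R, Measurable (χ R) := fun R =>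
    measurable_const.indicator Metric.isClosed_closedBall.measurableSet
  have hχ : ∀ R, IsBddMeas (χ R) := fun R => ⟨hχm R, 1, fun ξ => by
    by_cases h : ξ ∈ Metric.closedBall (0 : Rn n) R <;> simp [hχdef, h]⟩
  have hχ2 : ∀ R, IsBddMeas (fun ξ => χ R ξ * bracket 2 ξ) := fun R =>
    ⟨(hχm R).mul (measurable_bracket 2), 1 + (R : ℝ) ^ 2, fun ξ => by
      by_cases h : ξ ∈ Metric.closedBall (0 : Rn n) R
      · have h' : ‖ξ‖ ≤ R := by simpa using h
        simp only [hχdef, indicator_of_mem h, one_mul, bracket_two]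
        rw [abs_of_nonneg (by positivity)]
        gcongr
      · simp only [hχdef, indicator_of_notMem h, zero_mul, abs_zero]
        positivity⟩
  have hχχ : ∀ R ξ, χ R ξ * χ R ξ = χ R ξ := fun R ξ => by
    by_cases h : ξ ∈ Metric.closedBall (0 : Rn n) R <;> simp [hχdef, h]
  obtain ⟨D, hD⟩ := isCompact_Icc.exists_bound_of_continuousOn (hd.continuousOn (s := Icc 0 2))
  have hD0 : 0 ≤ D := (norm_nonneg _).trans (hD 0 (by simp))
  have key : ∀ R, cutoff (χ R) w t = cutoff (χ R) v t := by
    intro R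
    set Λ : L2 n →L[ℂ] L2 n := mulL (fun ξ => χ R ξ * laplaceSymbol ξ) with hΛ
    have hLip : ∀ t ∈ Ico (0 : ℝ) 2, LipschitzOnWith ⟨1 + ‖Λ‖ + D, by positivity⟩
        (fun z : L2 n × L2 n => (z.2, -(Λ z.1) - d t • z.2)) univ := by
      intro t ht
      refine LipschitzOnWith.of_dist_le_mul fun z _ y _ => ?_
      have h1 : ‖z.1 - y.1‖ ≤ ‖z - y‖ := norm_fst_le (z - y)
      have h2 : ‖z.2 - y.2‖ ≤ ‖z - y‖ := norm_snd_le (z - y)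
      rw [dist_eq_norm, dist_eq_norm, Prod.mk_sub_mk, Prod.norm_mk]
      change _ ≤ (1 + ‖Λ‖ + D) * _
      have h0 := norm_nonneg (z - y)
      refine max_le ?_ ?_
      · nlinarith [norm_nonneg Λ]
      · have e : -(Λ z.1) - d t • z.2 - (-(Λ y.1) - d t • y.2) =
            -(Λ (z.1 - y.1)) - d t • (z.2 - y.2) := by
          rw [map_sub, smul_sub]; abel
        rw [e]
        have h3 : ‖Λ (z.1 - y.1)‖ ≤ ‖Λ‖ * ‖z - y‖ :=
          (Λ.le_opNorm _).trans (mul_le_mul_of_nonneg_left h1 (norm_nonneg _))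
        have h4 : ‖d t • (z.2 - y.2)‖ ≤ D * ‖z - y‖ := by
          rw [norm_smul]
          exact mul_le_mul (hD t (Ico_subset_Icc_self ht)) h2 (norm_nonneg _) hD0
        have h5 := norm_sub_le (-(Λ (z.1 - y.1))) (d t • (z.2 - y.2))
        rw [norm_neg] at h5
        nlinarith
    have dw := fun t ht => hw.hasDerivWithinAt_cutoff (t := t) (hχ R) (hχ2 R) (hχχ R) ht
    have dv := fun t ht => hv.hasDerivWithinAt_cutoff (t := t) (hχ R) (hχ2 R) (hχχ R) ht
    exact ODE_solution_unique_of_mem_Icc_right (s := fun _ => univ) hLip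
      (fun t ht => (dw t ht).continuousWithinAt)
      (fun t ht => (dw t (Ico_subset_Icc_self ht)).Ici_of_Icc ht) (fun _ _ => mem_univ _)
      (fun t ht => (dv t ht).continuousWithinAt)
      (fun t ht => (dv t (Ico_subset_Icc_self ht)).Ici_of_Icc ht) (fun _ _ => mem_univ _)
      (by rw [hw.cutoff_zero, hv.cutoff_zero]) ht
  apply (Sobolev.ft n 1).injective
  apply Lp.ext
  -- Countably many radii, so one null set serves them all.
  have hae : ∀ᵐ ξ, ∀ R : ℕ, (χ R ξ : ℂ) * Sobolev.ft n 1 (w t) ξ =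
      (χ R ξ : ℂ) * Sobolev.ft n 1 (v t) ξ := by
    rw [ae_all_iff]
    intro R
    have h1 : mulL (χ R) (Sobolev.ft n 1 (w t)) = mulL (χ R) (Sobolev.ft n 1 (v t)) :=
      congrArg Prod.fst (key R)
    filter_upwards [mulL_ae (hχ R) (Sobolev.ft n 1 (w t)), mulL_ae (hχ R) (Sobolev.ft n 1 (v t))]
      with ξ e1 e2
    rw [← e1, ← e2, h1]
  filter_upwards [hae] with ξ hξ
  obtain ⟨R, hR⟩ := exists_nat_ge ‖ξ‖
  have hmem : ξ ∈ Metric.closedBall (0 : Rn n) R := by simpa using hR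
  simpa [hχdef, hmem] using hξ R

end IsEnergySolution

end Uniqueness

/-! ### Regularity and estimates for arbitrary solutions. -/

noncomputable section Estimates

open Filter Topology FourierTransform

namespace IsWaveFamily

variable {n : ℕ} {d : ℝ → ℝ} {e : ℝ} {C : ℕ → ℝ} {P Q : ℝ → ℕ → ℝ → ℝ} {u₀ : Sobolev n 1}
  {u₁ : L2 n} {u : ℝ → Sobolev n 1}

/-- By uniqueness u is the explicit solution on [0,2], so its derivatives within this interval are
the jets already estimated. -/
theorem contDiffOn_of_isEnergySolution (h : IsWaveFamily n d e C P Q) (hd : Continuous d)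
    (hu : IsEnergySolution d u₀ u₁ u) {s : ℝ} (hs : s ≤ 1) {N : ℕ} (hN : s + N ≤ 1) :
    ContDiffOn ℝ N (curveIn hs u) (Icc 0 2) ∧ ∀ t ∈ Icc (0 : ℝ) 2,
      ‖timeDeriv hs N u t‖ ≤ C N * e ^ (N - 1) * (‖u₀‖ + ‖u₁‖) := by
  obtain ⟨h1, h2⟩ := h.contDiffOn_curveIn u₀ u₁ hs hN
  have heq : EqOn (curveIn hs u) (curveIn hs (waveJet P Q u₀ u₁ 1 0)) (Icc 0 2) := by
    intro t ht
    rw [curveIn, curveIn, hu.eqOn hd (h.isEnergySolution u₀ u₁) ht]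
  refine ⟨h1.congr heq, fun t ht => ?_⟩
  have h3 : timeDeriv hs N u t = waveJet P Q u₀ u₁ s N t := by
    rw [← h2 N le_rfl t ht, timeDeriv, timeDeriv, iteratedDerivWithin_congr heq ht]
  rw [h3]
  exact h.norm_waveJet_le u₀ u₁ hN ht

theorem energy_estimate (h : IsWaveFamily n d e C P Q) (hC : ∀ m, 0 ≤ C m) (he : 1 ≤ e)
    (hd : Continuous d) (hu : IsEnergySolution d u₀ u₁ u) (k : ℕ) :
    HasEnergyRegularity k u ∧ ∀ t ∈ Icc (0 : ℝ) 2,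
      energyNorm k u t ≤ (C (1 + k) + C k) * (‖u₀‖ + ‖u₁‖) * e ^ k := by
  have h1 := h.contDiffOn_of_isEnergySolution hd hu (neg_natCast_le_one k) (N := 1 + k)
    (by push_cast; linarith)
  have h2 := h.contDiffOn_of_isEnergySolution hd hu (one_sub_natCast_le_one k) (N := k)
    (by linarith)
  refine ⟨⟨h1.1, h2.1⟩, fun t ht => ?_⟩
  have h3 := h1.2 t ht
  have h4 := h2.2 t ht
  rw [Nat.add_sub_cancel_left] at h3
  -- The order 1 + k costs exactly e^k; the order k costs less, which e ≥ 1 absorbs.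
  have h5 : C k * e ^ (k - 1) * (‖u₀‖ + ‖u₁‖) ≤ C k * e ^ k * (‖u₀‖ + ‖u₁‖) := by
    have := hC k
    gcongr
    omega
  rw [energyNorm]
  nlinarith

end IsWaveFamily

theorem DampingBound.isModerateCoefficient {A : ℝ} {D : ℕ → ℝ} {d : ℝ → ℝ → ℝ}
    (h : ∀ ε ∈ Ioc (0 : ℝ) 1, DampingBound A D ε⁻¹ (d ε)) : IsModerateCoefficient d := by
  -- The exponent N = -1 accounts for the extra ε⁻¹ already present at k = 0.
  refine ⟨fun ε hε => (h ε hε).contDiff.contDiffOn, -1, fun k => ⟨D k, fun ε hε t ht => ?_⟩⟩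
  have h1 := (h ε hε).abs_iteratedDeriv_le k t ht
  have h2 : ε ^ ((-1 : ℝ) - k) = ε⁻¹ ^ (k + 1) := by
    rw [← Real.rpow_natCast, Real.inv_rpow hε.1.le, ← Real.rpow_neg hε.1.le]
    congr 1
    push_cast
    ring
  rwa [h2, iteratedDerivWithin_eq_iteratedDeriv (uniqueDiffOn_Icc (by norm_num))
    ((h ε hε).contDiff.contDiffAt.of_le (by exact_mod_cast le_top)) ht]

end Estimates

/-! ### Assembly of the main theorem. -/

theorem mainTheorem3 (n : ℕ) (b : ℝ → ℝ) (b₀ : ℝ) (hb₀ : 0 < b₀) (hb_lower : ∀ t, b₀ ≤ b t)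
    (hb : IsPiecewiseCbInfty b) (K : ℝ) (hK : 0 < K) (ψ : ℝ → ℝ) (hψ : IsMollifier K ψ) :
    -- existence and uniqueness of the solution of every regularised Cauchy problem
    (∀ (u₀ : Sobolev n 1) (u₁ : L2 n), ∀ ε ∈ Ioc (0 : ℝ) 1,
      ∃ u : ℝ → Sobolev n 1, IsEnergySolution (dissipation b ψ ε) u₀ u₁ u ∧
        ∀ w : ℝ → Sobolev n 1, IsEnergySolution (dissipation b ψ ε) u₀ u₁ w →
          EqOn w u (Icc 0 2)) ∧
    -- the estimate, with a constant that is independent of the data, of `ε` and of `t`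
    (∀ k : ℕ, ∃ C : ℝ, ∀ (u₀ : Sobolev n 1) (u₁ : L2 n) (u : ℝ → ℝ → Sobolev n 1),
      (∀ ε ∈ Ioc (0 : ℝ) 1, IsEnergySolution (dissipation b ψ ε) u₀ u₁ (u ε)) →
      ∀ ε ∈ Ioc (0 : ℝ) 1, HasEnergyRegularity k (u ε) ∧
        ∀ t ∈ Icc (0 : ℝ) 2, energyNorm k (u ε) t ≤ C * (‖u₀‖ + ‖u₁‖) * (ε ^ k)⁻¹) ∧
    -- a very weak solution of energy type exists, and every solution net is one
    (∀ (u₀ : Sobolev n 1) (u₁ : L2 n),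
      (∃ u : ℝ → ℝ → Sobolev n 1, IsVeryWeakSolution (dissipation b ψ) u₀ u₁ u) ∧
      ∀ u : ℝ → ℝ → Sobolev n 1,
        (∀ ε ∈ Ioc (0 : ℝ) 1, IsEnergySolution (dissipation b ψ ε) u₀ u₁ (u ε)) →
        IsVeryWeakSolution (dissipation b ψ) u₀ u₁ u) := by

  obtain ⟨A, D, hD0, hD⟩ := exists_dampingBound hb₀ hb_lower hb hψ
  -- The constants are fixed before the data and ε; this is the uniformity claimed in the estimate.
  obtain ⟨C, hC0, hC⟩ := exists_isWaveFamily n A D hD0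
  have he : ∀ ε ∈ Ioc (0 : ℝ) 1, 1 ≤ ε⁻¹ := fun ε hε => (one_le_inv₀ hε.1).mpr hε.2
  have hdc : ∀ ε ∈ Ioc (0 : ℝ) 1, Continuous (dissipation b ψ ε) := fun ε hε =>
    (hD ε hε).contDiff.continuous
  have hex : ∀ (u₀ : Sobolev n 1) (u₁ : L2 n), ∀ ε ∈ Ioc (0 : ℝ) 1,
      ∃ u : ℝ → Sobolev n 1, IsEnergySolution (dissipation b ψ ε) u₀ u₁ u := by
    intro u₀ u₁ ε hε
    obtain ⟨P, Q, h⟩ := hC ε⁻¹ _ (he ε hε) (hD ε hε)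
    exact ⟨_, h.isEnergySolution u₀ u₁⟩
  have hest : ∀ (k : ℕ) (u₀ : Sobolev n 1) (u₁ : L2 n) (u : ℝ → ℝ → Sobolev n 1),
      (∀ ε ∈ Ioc (0 : ℝ) 1, IsEnergySolution (dissipation b ψ ε) u₀ u₁ (u ε)) →
      ∀ ε ∈ Ioc (0 : ℝ) 1, HasEnergyRegularity k (u ε) ∧ ∀ t ∈ Icc (0 : ℝ) 2,
        energyNorm k (u ε) t ≤ (C (1 + k) + C k) * (‖u₀‖ + ‖u₁‖) * (ε ^ k)⁻¹ := by
    intro k u₀ u₁ u hu ε hε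
    obtain ⟨P, Q, h⟩ := hC ε⁻¹ _ (he ε hε) (hD ε hε)
    rw [← inv_pow]
    exact h.energy_estimate hC0 (he ε hε) (hdc ε hε) (hu ε hε) k
  have hvw : ∀ (u₀ : Sobolev n 1) (u₁ : L2 n) (u : ℝ → ℝ → Sobolev n 1),
      (∀ ε ∈ Ioc (0 : ℝ) 1, IsEnergySolution (dissipation b ψ ε) u₀ u₁ (u ε)) →
      IsVeryWeakSolution (dissipation b ψ) u₀ u₁ u := by
    intro u₀ u₁ u hu
    -- The solution net is moderate with N = 0, one power of ε better than the coefficient.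
    refine ⟨DampingBound.isModerateCoefficient hD, hu,
      fun k ε hε => (hest k u₀ u₁ u hu ε hε).1, 0, fun k =>
        ⟨(C (1 + k) + C k) * (‖u₀‖ + ‖u₁‖), fun ε hε t ht => ?_⟩⟩
    rw [zero_sub, Real.rpow_neg hε.1.le, Real.rpow_natCast]
    exact (hest k u₀ u₁ u hu ε hε).2 t ht
  refine ⟨fun u₀ u₁ ε hε => ?_, fun k => ⟨_, hest k⟩, fun u₀ u₁ => ⟨?_, hvw u₀ u₁⟩⟩
  · obtain ⟨u, hu⟩ := hex u₀ u₁ ε hε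
    exact ⟨u, hu, fun w hw => hw.eqOn (hdc ε hε) hu⟩
  · choose! u hu using hex u₀ u₁
    exact ⟨u, hvw u₀ u₁ u hu⟩
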